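/- In the \textsc{Fall $k$-Coloring} problem one is given a finite simple undirected graph $G=(V,E)$ and asks whether $V$ can be partitioned into $k$ (nonempty) independent dominating sets; here $S\subseteq V$ is independent if its vertices are pairwise non-adjacent, and dominating if every vertex of $V$ is in $S$ or adjacent to a vertex of $S$. Let the model of computation be the random access machine on natural numbers with operations $+$, $-$ (truncated), $\cdot$, $\lfloor\,\cdot/\cdot\,\rfloor$, indirect addressing, and logarithmic cost: every step costs one plus the bit lengths of the numbers and memory addresses it handles, and the space used is the maximum, over the states visited, of the total bit length of the contents of all registers and of the addresses and contents of all nonzero memory cells. The input consists of the adjacency matrix of $G$ and the numbers $n=|V|$ and $k$ in binary; let $\ell(k)$ be the number of binary digits of $k$. \begin{enumerate} \item There are a program and polynomials $P,Q$ such that, for all $n$, all $k$ and all $n$-vertex graphs $G$, the program decides whether $G$ has a fall $k$-coloring in time at most $3^n\,P(n+\ell(k))$ and space at most $Q(n+\ell(k))$. \item There are a program and polynomials $P,Q$ such that, for all $n$, all $k$ and all $n$-vertex graphs $G$, the program decides whether $G$ has a fall $k$-coloring in time at most $2^n\,P(n+\ell(k))$ and space at most $2^n\,Q(n+\ell(k))$.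 \end{enumerate} For $k$ fixed these bounds are $3^n n^{O(1)}$ time and $n^{O(1)}$ space, respectively $2^n n^{O(1)}$ time and space. -/

import Mathlib

/-! ### Fall colorings -/

/-- `S` is a dominating set of `G`: every vertex is in `S` or adjacent to a vertex in `S`. -/
def SimpleGraph.IsDominatingSet {V : Type*} (G : SimpleGraph V) (S : Set V) : Prop :=
  ∀ v, v ∈ S ∨ ∃ u ∈ S, G.Adj v u

/-- `V` can be partitioned into exactly `k` (nonempty) independent dominating sets. -/
def SimpleGraph.FallColorable {V : Type*} [Fintype V] [DecidableEq V] (G : SimpleGraph V)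
    (k : ℕ) : Prop :=
  ∃ P : Finpartition (Finset.univ : Finset V), P.parts.card = k ∧
    ∀ S ∈ P.parts, G.IsIndepSet (S : Set V) ∧ G.IsDominatingSet (S : Set V)

/-! ### Random access machines with logarithmic cost -/

namespace RAM

/-- A state of the machine: registers, which a program addresses directly, and a memory, which is
addressed indirectly. All but finitely many cells contain `0`. -/
structure State where
  reg : ℕ →₀ ℕ
  mem : ℕ →₀ ℕ

/-- The number of bits stored in a state: the lengths of all register contents, plus, for every
nonzero memory cell, the length of its address and the length of its content. -/
def State.space (σ : State) : ℕ :=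
  (σ.reg.sum fun _ x => Nat.size x) + σ.mem.sum fun a x => Nat.size a + Nat.size x

/-- Assign a value to a register. -/
noncomputable def State.setReg (σ : State) (r x : ℕ) : State :=
  { σ with reg := σ.reg.update r x }

/-- Assign a value to a memory cell. -/
noncomputable def State.setMem (σ : State) (a x : ℕ) : State :=
  { σ with mem := σ.mem.update a x }

/-- The arithmetic operations on natural numbers. -/
inductive ArithOp
  | add
  | sub
  | mul
  | div

/-- Subtraction is truncated, and division rounds down, with value `0` for the divisor `0`. -/
def ArithOp.eval : ArithOp → ℕ → ℕ → ℕ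
  | add, x, y => x + y
  | sub, x, y => x - y
  | mul, x, y => x * y
  | div, x, y => x / y

/-- The elementary instructions. -/
inductive Instr
  /-- `reg r := c` -/
  | const (r c : ℕ)
  /-- `reg r := reg a ∘ reg b` for an arithmetic operation `∘` -/
  | arith (o : ArithOp) (r a b : ℕ)
  /-- `reg r := mem (reg a)` -/
  | load (r a : ℕ)
  /-- `mem (reg a) := reg r` -/
  | store (a r : ℕ)

/-- The effect of an instruction. -/
noncomputable def Instr.run : Instr → State → State
  | const r c, σ => σ.setReg r c
  | arith o r a b, σ => σ.setReg r (o.eval (σ.reg a) (σ.reg b))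
  | load r a, σ => σ.setReg r (σ.mem (σ.reg a))
  | store a r, σ => σ.setMem (σ.reg a) (σ.reg r)

/-- The logarithmic cost of an instruction: one plus the lengths of all numbers (operands and
memory addresses) that it handles. -/
def Instr.cost : Instr → State → ℕ
  | const _ c, _ => 1 + Nat.size c
  | arith _ _ a b, σ => 1 + Nat.size (σ.reg a) + Nat.size (σ.reg b)
  | load _ a, σ => 1 + Nat.size (σ.reg a) + Nat.size (σ.mem (σ.reg a))
  | store a r, σ => 1 + Nat.size (σ.reg a) + Nat.size (σ.reg r)

/-- Structured programs. -/
inductive Prog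
  | skip
  | instr (i : Instr)
  | seq (p q : Prog)
  /-- If `reg r ≠ 0` then `p` else `q`. -/
  | cond (r : ℕ) (p q : Prog)
  /-- While `reg r ≠ 0` do `p`. -/
  | loop (r : ℕ) (p : Prog)

/-- `Exec p σ t s σ'`: started in state `σ`, the program `p` halts in state `σ'`, its running time
(the total cost of all instructions and tests executed) is `t`, and the maximum of the space of all
states visited, including `σ` and `σ'`, is `s`. -/
inductive Exec : Prog → State → ℕ → ℕ → State → Prop
  | skip (σ : State) : Exec .skip σ 1 σ.space σ
  | instr (i : Instr) (σ : State) :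
      Exec (.instr i) σ (i.cost σ) (max σ.space (i.run σ).space) (i.run σ)
  | seq {p q : Prog} {σ ρ τ : State} {t₁ s₁ t₂ s₂ : ℕ} :
      Exec p σ t₁ s₁ ρ → Exec q ρ t₂ s₂ τ → Exec (.seq p q) σ (t₁ + t₂) (max s₁ s₂) τ
  | condTrue {r : ℕ} {p q : Prog} {σ τ : State} {t s : ℕ} :
      σ.reg r ≠ 0 → Exec p σ t s τ → Exec (.cond r p q) σ (1 + Nat.size (σ.reg r) + t) s τ
  | condFalse {r : ℕ} {p q : Prog} {σ τ : State} {t s : ℕ} :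
      σ.reg r = 0 → Exec q σ t s τ → Exec (.cond r p q) σ (1 + Nat.size (σ.reg r) + t) s τ
  | loopTrue {r : ℕ} {p : Prog} {σ ρ τ : State} {t₁ s₁ t₂ s₂ : ℕ} :
      σ.reg r ≠ 0 → Exec p σ t₁ s₁ ρ → Exec (.loop r p) ρ t₂ s₂ τ →
      Exec (.loop r p) σ (1 + Nat.size (σ.reg r) + t₁ + t₂) (max s₁ s₂) τ
  | loopFalse {r : ℕ} {p : Prog} {σ : State} :
      σ.reg r = 0 → Exec (.loop r p) σ (1 + Nat.size (σ.reg r)) σ.space σ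

/-- The machine is deterministic, so the final state, the running time and the space of a halting
computation are determined by the program and the initial state. -/
theorem Exec.deterministic {p : Prog} {σ : State} {t s : ℕ} {τ : State} (h : Exec p σ t s τ) :
    ∀ {t' s' : ℕ} {τ' : State}, Exec p σ t' s' τ' → t = t' ∧ s = s' ∧ τ = τ' := by
  induction h with
  | skip => intro _ _ _ h'; cases h'; simp
  | instr => intro _ _ _ h'; cases h'; simp
  | seq _ _ ih₁ ih₂ =>
    intro _ _ _ h'
    cases h' with
    | seq a b =>
      obtain ⟨rfl, rfl, rfl⟩ := ih₁ a
      obtain ⟨rfl, rfl, rfl⟩ := ih₂ b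
      simp
  | condTrue hr _ ih =>
    intro _ _ _ h'
    cases h' with
    | condTrue _ a => obtain ⟨rfl, rfl, rfl⟩ := ih a; simp
    | condFalse h0 => exact absurd h0 hr
  | condFalse hr _ ih =>
    intro _ _ _ h'
    cases h' with
    | condTrue h0 => exact absurd hr h0
    | condFalse _ a => obtain ⟨rfl, rfl, rfl⟩ := ih a; simp
  | loopTrue hr _ _ ih₁ ih₂ =>
    intro _ _ _ h'
    cases h' with
    | loopTrue _ a b =>
      obtain ⟨rfl, rfl, rfl⟩ := ih₁ a
      obtain ⟨rfl, rfl, rfl⟩ := ih₂ b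
      simp
    | loopFalse h0 => exact absurd h0 hr
  | loopFalse hr =>
    intro _ _ _ h'
    cases h' with
    | loopTrue h0 => exact absurd hr h0
    | loopFalse => simp

open Classical in
/-- The input for a graph `G` on `n` vertices and a number `k`: register `0` contains `n`,
register `1` contains `k`, and the memory contains the adjacency matrix of `G`, row by row. -/
noncomputable def graphInput {n : ℕ} (G : SimpleGraph (Fin n)) (k : ℕ) : State where
  reg := Finsupp.single 0 n + Finsupp.single 1 k
  mem := ∑ i : Fin n, ∑ j : Fin n,
    Finsupp.single ((i : ℕ) * n + j) (if G.Adj i j then 1 else 0)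

open Classical in
/-- The program `p` halts on every input `(G, k)` and leaves in register `0` the number `1` if `G`
has a fall `k`-coloring and `0` otherwise; it takes time at most `T n k` and space at most `S n k`,
where `n` is the number of vertices of `G`. -/
def SolvesFallColoring (p : Prog) (T S : ℕ → ℕ → ℕ) : Prop :=
  ∀ (n k : ℕ) (G : SimpleGraph (Fin n)), ∃ (t s : ℕ) (τ : State),
    Exec p (graphInput G k) t s τ ∧
    τ.reg 0 = (if G.FallColorable k then 1 else 0) ∧ t ≤ T n k ∧ s ≤ S n k

end RAM

/-!
Let `F` be the family of nonempty independent dominating sets of a graph on `n` vertices. A fall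
`k`-coloring amounts to a `k`-tuple of members of `F` that cover the vertices and whose sizes add
up to `n` (`exactCovers_nonempty_iff`). By inclusion–exclusion over the set `X` of vertices in which
all members of the tuple lie,

  `∑ X, (-1) ^ (n - |X|) * (∑ S ∈ F, S ⊆ X, y ^ |S|) ^ k`

is the sum of `y ^ (|S₁| + ⋯ + |Sₖ|)` over all `k`-tuples that cover the vertices
(`sum_neg_one_pow_mul_subsetSum_pow`). All these exponents are at least `n`, and the tuples with
exponent `n` are the colorings with ordered classes. Replacing `k` by the minimum of `k` and `n + 1`
does not change the answer; then the number of these tuples is less than `y = 2 ^ (n + 1) ^ 2`, hence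
it is the digit of the sum in position `n` to the base `y`, which one division and one remainder
extract (`coverSum_div_mod`), and all numbers involved have polynomially many digits.

The two algorithms differ in how they find the inner sums, for sets coded as bit masks. In
polynomial space, the submasks of every `X` are enumerated, `3 ^ n` pairs in all (`sum_deposit`,
`sum_two_pow_pop`). In time `2 ^ n`, the inner sums are the zeta transform of the weights of the
masks, which is tabulated round by round (`zeta_eq_sum_maskSub`).

For the machine, `Run` counts steps while it checks that all numbers have at most `B` bits and that
only cells below an address `A` are used; time and space then follow from the number of steps, `B`
and `A` (`Run.exec`). Programs are built from code generators `Gen`, whose specification `EvalsTo`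
is stable under any use of fresh registers, so that the combinators for arithmetic, memory access,
local binding and loops compose without reference to concrete registers.
-/

namespace RAM

/-! ### Unit-cost executions under an invariant -/

@[simp] theorem State.setReg_reg (σ : State) (r x q : ℕ) :
    (σ.setReg r x).reg q = if q = r then x else σ.reg q := by
  classical
  simp [State.setReg, Finsupp.update_apply]

@[simp] theorem State.setReg_mem (σ : State) (r x : ℕ) : (σ.setReg r x).mem = σ.mem := rfl

@[simp] theorem State.setMem_reg (σ : State) (a x : ℕ) : (σ.setMem a x).reg = σ.reg := rfl

@[simp] theorem State.setMem_mem (σ : State) (a x : ℕ) :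
    (σ.setMem a x).mem = σ.mem.update a x := rfl

/-- All registers and memory cells of the state hold numbers of at most `B` bits, and only cells
below the address `A` are in use. -/
structure Within (B A : ℕ) (σ : State) : Prop where
  reg_lt : ∀ r, σ.reg r < 2 ^ B
  mem_lt : ∀ a, σ.mem a < 2 ^ B
  mem_eq : ∀ a, A ≤ a → σ.mem a = 0

/-- `Run B A p σ N τ`: the program `p` takes the state `σ` to the state `τ` in `N` steps, and all
states visited stay within the bounds `B` and `A`. There are no rules for `skip` and `cond`, which
the programs below do not need. -/
inductive Run (B A : ℕ) : Prog → State → ℕ → State → Prop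
  | instr {i : Instr} {σ : State} :
      Within B A σ → Within B A (i.run σ) → Run B A (.instr i) σ 1 (i.run σ)
  | seq {p q : Prog} {σ ρ τ : State} {N M : ℕ} :
      Run B A p σ N ρ → Run B A q ρ M τ → Run B A (.seq p q) σ (N + M) τ
  | loopTrue {r : ℕ} {p : Prog} {σ ρ τ : State} {N M : ℕ} :
      σ.reg r ≠ 0 → Run B A p σ N ρ → Run B A (.loop r p) ρ M τ →
      Run B A (.loop r p) σ (1 + N + M) τ
  | loopFalse {r : ℕ} {p : Prog} {σ : State} :
      Within B A σ → σ.reg r = 0 → Run B A (.loop r p) σ 1 σ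

theorem Run.within_start {B A : ℕ} {p : Prog} {σ τ : State} {N : ℕ} (h : Run B A p σ N τ) :
    Within B A σ := by
  induction h with
  | instr h _ => exact h
  | seq _ _ ih _ => exact ih
  | loopTrue _ _ _ ih _ => exact ih
  | loopFalse h _ => exact h

theorem Run.within_end {B A : ℕ} {p : Prog} {σ τ : State} {N : ℕ} (h : Run B A p σ N τ) :
    Within B A τ := by
  induction h with
  | instr _ h => exact h
  | seq _ _ _ ih => exact ih
  | loopTrue _ _ _ _ ih => exact ih
  | loopFalse h _ => exact h

/-- All registers to which the instruction writes are below `R`. -/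
def Instr.WritesBelow (R : ℕ) : Instr → Prop
  | .const r _ => r < R
  | .arith _ r _ _ => r < R
  | .load r _ => r < R
  | .store _ _ => True

/-- All registers to which the program writes are below `R`. -/
def Prog.WritesBelow (R : ℕ) : Prog → Prop
  | .skip => True
  | .instr i => i.WritesBelow R
  | .seq p q => p.WritesBelow R ∧ q.WritesBelow R
  | .cond _ p q => p.WritesBelow R ∧ q.WritesBelow R
  | .loop _ p => p.WritesBelow R

theorem Instr.WritesBelow.mono {R R' : ℕ} (h : R ≤ R') {i : Instr} (hi : i.WritesBelow R) :
    i.WritesBelow R' := by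
  cases i <;> simp only [Instr.WritesBelow] at hi ⊢ <;> omega

theorem Prog.WritesBelow.mono {R R' : ℕ} (h : R ≤ R') {p : Prog} (hp : p.WritesBelow R) :
    p.WritesBelow R' := by
  induction p with
  | skip => trivial
  | instr i => exact Instr.WritesBelow.mono h hp
  | seq p q ihp ihq => exact ⟨ihp hp.1, ihq hp.2⟩
  | cond r p q ihp ihq => exact ⟨ihp hp.1, ihq hp.2⟩
  | loop r p ih => exact ih hp

theorem Prog.exists_writesBelow (p : Prog) : ∃ R, p.WritesBelow R := by
  induction p with
  | skip => exact ⟨0, trivial⟩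
  | instr i =>
    cases i with
    | const r c => exact ⟨r + 1, Nat.lt_succ_self r⟩
    | arith o r a b => exact ⟨r + 1, Nat.lt_succ_self r⟩
    | load r a => exact ⟨r + 1, Nat.lt_succ_self r⟩
    | store a r => exact ⟨0, trivial⟩
  | seq p q ihp ihq =>
    obtain ⟨R, hR⟩ := ihp
    obtain ⟨R', hR'⟩ := ihq
    exact ⟨max R R', hR.mono (le_max_left _ _), hR'.mono (le_max_right _ _)⟩
  | cond r p q ihp ihq =>
    obtain ⟨R, hR⟩ := ihp
    obtain ⟨R', hR'⟩ := ihq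
    exact ⟨max R R', hR.mono (le_max_left _ _), hR'.mono (le_max_right _ _)⟩
  | loop r p ih => exact ih

/-- Only registers below `R` are in use. -/
def RegsBelow (R : ℕ) (σ : State) : Prop := ∀ r, R ≤ r → σ.reg r = 0

theorem Within.space_le {B A R : ℕ} {σ : State} (h : Within B A σ) (hA : A ≤ 2 ^ B)
    (hR : RegsBelow R σ) : σ.space ≤ R * B + A * (2 * B) := by
  unfold State.space
  refine add_le_add ?_ ?_
  · rw [Finsupp.sum_of_support_subset (s := Finset.range R) _ ?_ _ (by simp)]
    · calc _ ≤ ∑ _r ∈ Finset.range R, B :=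
            Finset.sum_le_sum fun r _ => Nat.size_le.2 (h.reg_lt r)
        _ = _ := by simp
    · intro r hr
      by_contra hr'
      exact (Finsupp.mem_support_iff.1 hr) (hR r (by simpa using hr'))
  · have hsub : σ.mem.support ⊆ Finset.range A := by
      intro a ha
      by_contra ha'
      exact (Finsupp.mem_support_iff.1 ha) (h.mem_eq a (by simpa using ha'))
    calc σ.mem.sum (fun a x => Nat.size a + Nat.size x)
        ≤ ∑ _a ∈ σ.mem.support, 2 * B := by
          refine Finset.sum_le_sum fun a ha => ?_
          have h1 : Nat.size a ≤ B :=
            Nat.size_le.2 (lt_of_lt_of_le (Finset.mem_range.1 (hsub ha)) hA)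
          have h2 : Nat.size (σ.mem a) ≤ B := Nat.size_le.2 (h.mem_lt a)
          show Nat.size a + Nat.size (σ.mem a) ≤ _
          omega
      _ = σ.mem.support.card * (2 * B) := by simp
      _ ≤ A * (2 * B) := by
          gcongr
          simpa using Finset.card_le_card hsub

theorem Instr.cost_le {B A : ℕ} {σ : State} {i : Instr} (h : Within B A σ)
    (h' : Within B A (i.run σ)) : i.cost σ ≤ 1 + 2 * B := by
  have hr : ∀ r, Nat.size (σ.reg r) ≤ B := fun r => Nat.size_le.2 (h.reg_lt r)
  have hm : ∀ r, Nat.size (σ.mem r) ≤ B := fun r => Nat.size_le.2 (h.mem_lt r)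
  cases i with
  | const r c =>
    have := h'.reg_lt r
    simp only [Instr.run, State.setReg_reg, if_true] at this
    have := Nat.size_le.2 this
    simp only [Instr.cost]; omega
  | arith o r a b => simp only [Instr.cost]; have := hr a; have := hr b; omega
  | load r a => simp only [Instr.cost]; have := hr a; have := hm (σ.reg a); omega
  | store a r => simp only [Instr.cost]; have := hr a; have := hr r; omega

theorem Instr.regsBelow_run {R : ℕ} {σ : State} {i : Instr} (hi : i.WritesBelow R)
    (h : RegsBelow R σ) : RegsBelow R (i.run σ) := by
  intro q hq
  cases i <;> simp only [Instr.WritesBelow] at hi <;> simp only [Instr.run, State.setReg_reg,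
    State.setMem_reg, h q hq, ite_eq_right_iff] <;> omega

/-- An execution of `N` steps within the bounds has logarithmic cost at most `N * (1 + 2 * B)`;
its space is bounded because the registers in use are among those that the program mentions. -/
theorem Run.exec {B A R : ℕ} {p : Prog} {σ τ : State} {N : ℕ} (h : Run B A p σ N τ)
    (hA : A ≤ 2 ^ B) (hp : p.WritesBelow R) (hσ : RegsBelow R σ) :
    RegsBelow R τ ∧ ∃ t s, Exec p σ t s τ ∧ t ≤ N * (1 + 2 * B) ∧ s ≤ R * B + A * (2 * B) := by
  induction h with
  | @instr i σ h h' =>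
    have hb := Instr.regsBelow_run hp hσ
    exact ⟨hb, _, _, Exec.instr i σ, by simpa using Instr.cost_le h h',
      max_le (h.space_le hA hσ) (h'.space_le hA hb)⟩
  | seq _ _ ih ih' =>
    obtain ⟨hb, t, s, he, ht, hs⟩ := ih hp.1 hσ
    obtain ⟨hb', t', s', he', ht', hs'⟩ := ih' hp.2 hb
    exact ⟨hb', _, _, .seq he he', by rw [add_mul]; omega, max_le hs hs'⟩
  | @loopTrue r p σ ρ τ N M h0 h1 _ ih ih' =>
    obtain ⟨hb, t, s, he, ht, hs⟩ := ih hp hσ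
    obtain ⟨hb', t', s', he', ht', hs'⟩ := ih' hp hb
    refine ⟨hb', _, _, .loopTrue h0 he he', ?_, max_le hs hs'⟩
    have := Nat.size_le.2 (h1.within_start.reg_lt r)
    rw [add_mul, add_mul]; omega
  | @loopFalse r p σ h h0 =>
    refine ⟨hσ, _, _, .loopFalse h0, ?_, h.space_le hA hσ⟩
    have := Nat.size_le.2 (h.reg_lt r)
    omega

/-! ### Code generators -/

/-- A code generator: for every `d`, a program that leaves its result in register `d`, may use the
registers above `d` as scratch space, and preserves the registers below `d`. -/
abbrev Gen := ℕ → Prog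

/-- A world describes what is known about a state: the contents `reg r` of the registers `r`
below `depth`. -/
structure World where
  depth : ℕ
  reg : ℕ → ℕ

instance : LE World where
  le w w' := w.depth ≤ w'.depth ∧ ∀ r < w.depth, w'.reg r = w.reg r

instance : Preorder World where
  le_refl w := ⟨le_rfl, fun _ _ => rfl⟩
  le_trans _ _ _ h h' :=
    ⟨h.1.trans h'.1, fun r hr => (h'.2 r (hr.trans_le h.1)).trans (h.2 r hr)⟩

/-- Started in any state that agrees with the world `w` and has memory `μ`, the code of `c`, at
every depth not below that of `w`, computes the value `v` and changes the memory to `ν` in at most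
`N` steps, all within the bounds `B` and `A`. -/
def EvalsTo (B A : ℕ) (w : World) (μ : ℕ →₀ ℕ) (c : Gen) (v : ℕ) (ν : ℕ →₀ ℕ) (N : ℕ) : Prop :=
  ∀ (d : ℕ) (σ : State), w.depth ≤ d → Within B A σ → (∀ r < w.depth, σ.reg r = w.reg r) →
    σ.mem = μ → ∃ M ≤ N, ∃ τ, Run B A (c d) σ M τ ∧ τ.reg d = v ∧
      (∀ r < d, τ.reg r = σ.reg r) ∧ τ.mem = ν

/-- Evaluation that leaves the memory as it is. -/
abbrev Evals (B A : ℕ) (w : World) (μ : ℕ →₀ ℕ) (c : Gen) (v N : ℕ) : Prop :=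
  EvalsTo B A w μ c v μ N

/-- Evaluation in at most two steps and with any memory, as for variables and constants. -/
def IsAtom (B A : ℕ) (w : World) (c : Gen) (v : ℕ) : Prop :=
  ∀ μ, Evals B A w μ c v 2

section Generators

variable {B A : ℕ} {w w' : World} {μ μ' μ'' : ℕ →₀ ℕ} {c c' : Gen} {v v' N N' : ℕ}

theorem EvalsTo.mono (h : EvalsTo B A w μ c v μ' N) (hw : w ≤ w') :
    EvalsTo B A w' μ c v μ' N := fun d σ hd hσ hr hm =>
  h d σ (hw.1.trans hd) hσ (fun r hr' => (hr r (hr'.trans_le hw.1)).trans (hw.2 r hr')) hm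

theorem EvalsTo.le (h : EvalsTo B A w μ c v μ' N) (hN : N ≤ N') :
    EvalsTo B A w μ c v μ' N' := fun d σ hd hσ hr hm => by
  obtain ⟨M, hM, h⟩ := h d σ hd hσ hr hm
  exact ⟨M, hM.trans hN, h⟩

theorem EvalsTo.congr (h : EvalsTo B A w μ c v μ' N) (hv : v = v') :
    EvalsTo B A w μ c v' μ' N := hv ▸ h

theorem IsAtom.mono (h : IsAtom B A w c v) (hw : w ≤ w') : IsAtom B A w' c v :=
  fun μ => (h μ).mono hw

/-- Setting a register keeps the state within the bounds if the value does. -/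
theorem Within.setReg {σ : State} (h : Within B A σ) (r : ℕ) {x : ℕ} (hx : x < 2 ^ B) :
    Within B A (σ.setReg r x) where
  reg_lt q := by
    rw [State.setReg_reg]
    split
    · exact hx
    · exact h.reg_lt q
  mem_lt := h.mem_lt
  mem_eq := h.mem_eq

theorem run_const {σ : State} (h : Within B A σ) (r : ℕ) {x : ℕ} (hx : x < 2 ^ B) :
    Run B A (.instr (.const r x)) σ 1 (σ.setReg r x) :=
  .instr (i := .const r x) h (h.setReg r hx)

theorem run_arith {σ : State} (h : Within B A σ) (o : ArithOp) (r a b : ℕ)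
    (hx : o.eval (σ.reg a) (σ.reg b) < 2 ^ B) :
    Run B A (.instr (.arith o r a b)) σ 1 (σ.setReg r (o.eval (σ.reg a) (σ.reg b))) :=
  .instr (i := .arith o r a b) h (h.setReg r hx)

/-- A constant. -/
def constC (x : ℕ) : Gen := fun d => .instr (.const d x)

theorem isAtom_const {x : ℕ} (hx : x < 2 ^ B) : IsAtom B A w (constC x) x := by
  intro μ d σ _ hσ _ hm
  exact ⟨1, by omega, _, run_const hσ d hx, by simp,
    fun r hr => by simp [hr.ne], hm⟩

/-- Copy a register; sums serve because the machine has no instruction for this. -/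
def move (r s : ℕ) : Prog := .seq (.instr (.const r 0)) (.instr (.arith .add r r s))

theorem run_move {σ : State} (h : Within B A σ) {r s : ℕ} (hrs : s ≠ r) :
    ∃ τ, Run B A (move r s) σ 2 τ ∧ τ.reg r = σ.reg s ∧ (∀ q, q ≠ r → τ.reg q = σ.reg q) ∧
      τ.mem = σ.mem := by
  have h1 := run_const h r (x := 0) (Nat.two_pow_pos B)
  refine ⟨_, .seq h1 (run_arith h1.within_end .add r r s ?_), ?_, ?_, rfl⟩
  · simpa [ArithOp.eval, hrs] using h.reg_lt s
  · simp [ArithOp.eval, hrs]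
  · intro q hq; simp [hq]

/-- The content of register `r`. -/
def varC (r : ℕ) : Gen := fun d => move d r

theorem isAtom_var {r : ℕ} (hr : r < w.depth) : IsAtom B A w (varC r) (w.reg r) := by
  intro μ d σ hd hσ hw hm
  obtain ⟨τ, h1, h2, h3, h4⟩ := run_move hσ (r := d) (s := r) (by omega)
  exact ⟨2, le_rfl, τ, h1, h2.trans (hw r hr), fun q hq => h3 q hq.ne, h4.trans hm⟩

/-- An arithmetic operation. -/
def arithC (o : ArithOp) (c c' : Gen) : Gen := fun d =>
  .seq (c d) (.seq (c' (d + 1)) (.instr (.arith o d d (d + 1))))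

theorem Evals.arith' (o : ArithOp) (h : Evals B A w μ c v N) (h' : Evals B A w μ c' v' N')
    (hv : v < 2 ^ B → o.eval v v' < 2 ^ B) :
    Evals B A w μ (arithC o c c') (o.eval v v') (N + N' + 1) := by
  intro d σ hd hσ hw hm
  obtain ⟨M, hM, τ, h1, h2, h3, h4⟩ := h d σ hd hσ hw hm
  obtain ⟨M', hM', τ', h1', h2', h3', h4'⟩ := h' (d + 1) τ (by omega) h1.within_end
    (fun r hr => (h3 r (by omega)).trans (hw r hr)) h4
  have e : τ'.reg d = v := (h3' d (by omega)).trans h2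
  have hlt : o.eval (τ'.reg d) (τ'.reg (d + 1)) < 2 ^ B := by
    rw [e, h2']
    exact hv (h2 ▸ h1.within_end.reg_lt d)
  refine ⟨M + (M' + 1), by omega, _, .seq h1 (.seq h1' (run_arith h1'.within_end o _ _ _ hlt)),
    ?_, ?_, h4'⟩
  · simp [e, h2']
  · intro r hr
    simp [hr.ne, h3' r (by omega), h3 r hr]

/-- The sum. -/
def addC (a b : Gen) : Gen := arithC .add a b
/-- The truncated difference. -/
def subC (a b : Gen) : Gen := arithC .sub a b
/-- The product. -/
def mulC (a b : Gen) : Gen := arithC .mul a b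
/-- The quotient, rounded down. -/
def divC (a b : Gen) : Gen := arithC .div a b

theorem Evals.add (h : Evals B A w μ c v N) (h' : Evals B A w μ c' v' N')
    (hv : v + v' < 2 ^ B) : Evals B A w μ (addC c c') (v + v') (N + N' + 1) :=
  Evals.arith' .add h h' fun _ => hv

theorem Evals.mul (h : Evals B A w μ c v N) (h' : Evals B A w μ c' v' N')
    (hv : v * v' < 2 ^ B) : Evals B A w μ (mulC c c') (v * v') (N + N' + 1) :=
  Evals.arith' .mul h h' fun _ => hv

theorem Evals.sub (h : Evals B A w μ c v N) (h' : Evals B A w μ c' v' N') :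
    Evals B A w μ (subC c c') (v - v') (N + N' + 1) :=
  Evals.arith' .sub h h' fun hv => (Nat.sub_le v v').trans_lt hv

theorem Evals.div (h : Evals B A w μ c v N) (h' : Evals B A w μ c' v' N') :
    Evals B A w μ (divC c c') (v / v') (N + N' + 1) :=
  Evals.arith' .div h h' fun hv => (Nat.div_le_self v v').trans_lt hv

/-- The content of the memory cell with a given address. -/
def loadC (c : Gen) : Gen := fun d => .seq (c d) (.instr (.load d d))

theorem Evals.load (h : Evals B A w μ c v N) : Evals B A w μ (loadC c) (μ v) (N + 1) := by
  intro d σ hd hσ hw hm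
  obtain ⟨M, hM, τ, h1, h2, h3, h4⟩ := h d σ hd hσ hw hm
  refine ⟨M + 1, by omega, _, .seq h1 (.instr (i := .load d d) h1.within_end
    (h1.within_end.setReg d (h1.within_end.mem_lt _))), ?_, ?_, h4⟩
  · simp [Instr.run, h2, h4]
  · intro r hr
    simp [Instr.run, hr.ne, h3 r hr]

/-- Store the value of `c'` at the address `c`; the value of the whole is the address. -/
def storeC (c c' : Gen) : Gen := fun d =>
  .seq (c d) (.seq (c' (d + 1)) (.instr (.store d (d + 1))))

theorem Evals.store (h : Evals B A w μ c v N) (h' : Evals B A w μ c' v' N') (hA : v < A) :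
    EvalsTo B A w μ (storeC c c') v (μ.update v v') (N + N' + 1) := by
  intro d σ hd hσ hw hm
  obtain ⟨M, hM, τ, h1, h2, h3, h4⟩ := h d σ hd hσ hw hm
  obtain ⟨M', hM', τ', h1', h2', h3', hmem'⟩ := h' (d + 1) τ (by omega) h1.within_end
    (fun r hr => (h3 r (by omega)).trans (hw r hr)) h4
  have e : τ'.reg d = v := (h3' d (by omega)).trans h2
  have hin := h1'.within_end
  refine ⟨M + (M' + 1), by omega, _, .seq h1 (.seq h1' (.instr (i := .store d (d + 1)) hin ?_)),
    ?_, ?_, ?_⟩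
  · classical
    refine ⟨hin.reg_lt, fun a => ?_, fun a ha => ?_⟩
    · simp only [Instr.run, State.setMem_mem, Finsupp.update_apply]
      split
      · exact hin.reg_lt _
      · exact hin.mem_lt a
    · simp only [Instr.run, State.setMem_mem, Finsupp.update_apply, e]
      rw [if_neg (by omega)]
      exact hin.mem_eq a ha
  · simp [Instr.run, e]
  · intro r hr
    simp [Instr.run, h3' r (by omega), h3 r hr]
  · simp [Instr.run, e, h2', hmem']

/-- Run `c` for its effect on the memory, then evaluate `c'`. -/
def seqC (c c' : Gen) : Gen := fun d => .seq (c d) (c' d)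

theorem EvalsTo.seq (h : EvalsTo B A w μ c v μ' N) (h' : EvalsTo B A w μ' c' v' μ'' N') :
    EvalsTo B A w μ (seqC c c') v' μ'' (N + N') := by
  intro d σ hd hσ hw hm
  obtain ⟨M, hM, τ, h1, h2, h3, h4⟩ := h d σ hd hσ hw hm
  obtain ⟨M', hM', τ', h1', h2', h3', hmem'⟩ := h' d τ hd h1.within_end
    (fun r hr => (h3 r (by omega)).trans (hw r hr)) h4
  exact ⟨M + M', by omega, τ', .seq h1 h1', h2', fun r hr => (h3' r hr).trans (h3 r hr), hmem'⟩

/-- Evaluate `c` and bind its value in `body`. -/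
def letC (c : Gen) (body : Gen → Gen) : Gen := fun d =>
  .seq (c d) (.seq (body (varC d) (d + 1)) (move d (d + 1)))

theorem EvalsTo.bind {body : Gen → Gen} (h : EvalsTo B A w μ c v μ' N)
    (h' : ∀ w' ≥ w, ∀ x, v < 2 ^ B → IsAtom B A w' x v → EvalsTo B A w' μ' (body x) v' μ'' N') :
    EvalsTo B A w μ (letC c body) v' μ'' (N + N' + 2) := by
  intro d σ hd hσ hw hm
  obtain ⟨M, hM, τ, h1, h2, h3, h4⟩ := h d σ hd hσ hw hm
  have hw' : w ≤ ⟨d + 1, τ.reg⟩ :=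
    ⟨hd.trans (Nat.le_succ d), fun r hr => (h3 r (by omega)).trans (hw r hr)⟩
  obtain ⟨M', hM', τ', h1', h2', h3', h4'⟩ := h' _ hw' (varC d)
    (h2 ▸ h1.within_end.reg_lt d) (h2 ▸ isAtom_var (Nat.lt_succ_self d))
    (d + 1) τ le_rfl h1.within_end (fun _ _ => rfl) h4
  obtain ⟨τ'', h1'', h2'', h3'', h4''⟩ := run_move h1'.within_end (r := d) (s := d + 1) (by omega)
  refine ⟨M + (M' + 2), by omega, τ'', .seq h1 (.seq h1' h1''), h2''.trans h2', fun r hr => ?_,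
    h4''.trans h4'⟩
  rw [h3'' r hr.ne, h3' r (by omega), h3 r hr]

/-- The body of the loop in `foldC`: register `d` holds the accumulator, `d + 1` the number of
rounds to go, and `d + 2` the number of rounds done. -/
def foldBody (body : Gen → Gen → Gen) (d : ℕ) : Prog :=
  .seq (body (varC d) (varC (d + 2)) (d + 3)) (.seq (move d (d + 3))
    (.seq (.instr (.const (d + 3) 1)) (.seq (.instr (.arith .add (d + 2) (d + 2) (d + 3)))
      (.instr (.arith .sub (d + 1) (d + 1) (d + 3))))))

/-- Start with the value of `init` and replace the accumulator by the value of
`body accumulator i`, for `i = 0, 1, …, bound - 1`. -/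
def foldC (bound init : Gen) (body : Gen → Gen → Gen) : Gen := fun d =>
  .seq (init d) (.seq (bound (d + 1)) (.seq (.instr (.const (d + 2) 0))
    (.loop (d + 1) (foldBody body d))))

/-- The loop rule: `F i` and `mem i` are the accumulator and the memory after `i` rounds. -/
theorem EvalsTo.fold {bound init : Gen} {body : Gen → Gen → Gen} {m : ℕ} (F : ℕ → ℕ)
    (mem : ℕ → ℕ →₀ ℕ) (T : ℕ → ℕ) (hi : Evals B A w (mem 0) init (F 0) N)
    (hb : Evals B A w (mem 0) bound m N')
    (hs : ∀ i < m, ∀ w' ≥ w, ∀ a x, F i < 2 ^ B → IsAtom B A w' a (F i) → IsAtom B A w' x i →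
      EvalsTo B A w' (mem i) (body a x) (F (i + 1)) (mem (i + 1)) (T i)) :
    EvalsTo B A w (mem 0) (foldC bound init body) (F m) (mem m)
      (N + N' + 2 + ∑ i ∈ Finset.range m, (T i + 6)) := by
  intro d σ hd hσ hw hm
  obtain ⟨M, hM, τ, h1, h2, h3, h4⟩ := hi d σ hd hσ hw hm
  obtain ⟨M', hM', τ', h1', h2', h3', h4'⟩ := hb (d + 1) τ (by omega) h1.within_end
    (fun r hr => (h3 r (by omega)).trans (hw r hr)) h4
  have h0 := run_const h1'.within_end (d + 2) (x := 0) (Nat.two_pow_pos B)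
  have hmB : m < 2 ^ B := h2' ▸ h1'.within_end.reg_lt _
  -- Induction on the number `j` of rounds to go.
  have key : ∀ j ≤ m, ∀ ρ : State, Within B A ρ → (∀ r < d, ρ.reg r = σ.reg r) →
      ρ.reg d = F (m - j) → ρ.reg (d + 1) = j → ρ.reg (d + 2) = m - j → ρ.mem = mem (m - j) →
      ∃ L ≤ 1 + ∑ i ∈ Finset.Ico (m - j) m, (T i + 6), ∃ τ,
        Run B A (.loop (d + 1) (foldBody body d)) ρ L τ ∧ τ.reg d = F m ∧
          (∀ r < d, τ.reg r = σ.reg r) ∧ τ.mem = mem m := by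
    intro j
    induction j with
    | zero =>
      intro _ ρ hρ hr hF h1 _ hmem
      exact ⟨1, by simp, ρ, .loopFalse hρ h1, hF, hr, hmem⟩
    | succ j ih =>
      intro hj ρ hρ hr hF hj1 hj2 hmem
      have hlt : m - (j + 1) < m := by omega
      have hw' : w ≤ ⟨d + 3, ρ.reg⟩ :=
        ⟨hd.trans (by simp), fun r hr' => (hr r (by omega)).trans (hw r hr')⟩
      have hstep : m - (j + 1) + 1 = m - j := by omega
      obtain ⟨L₁, hL₁, ρ₁, a1, a2, a3, a4⟩ := hs _ hlt _ hw' (varC d) (varC (d + 2))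
        (hF ▸ hρ.reg_lt d) (hF ▸ isAtom_var (by simp)) (hj2 ▸ isAtom_var (by simp))
        (d + 3) ρ le_rfl hρ (fun _ _ => rfl) hmem
      rw [hstep] at a2 a4
      obtain ⟨ρ₂, b1, b2, b3, b4⟩ := run_move a1.within_end (r := d) (s := d + 3) (by omega)
      have c1 := run_const b1.within_end (d + 3) (x := 1) (by omega)
      have e2 : ρ₂.reg (d + 2) = m - (j + 1) := by
        rw [b3 _ (by omega), a3 _ (by omega), hj2]
      have e1 : ρ₂.reg (d + 1) = j + 1 := by
        rw [b3 _ (by omega), a3 _ (by omega), hj1]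
      have d1 := run_arith c1.within_end .add (d + 2) (d + 2) (d + 3)
        (by simp [ArithOp.eval, e2]; omega)
      have f1 := run_arith d1.within_end .sub (d + 1) (d + 1) (d + 3)
        (by simp [ArithOp.eval, e1]; omega)
      obtain ⟨L, hL, τ, g1, g2, g3, g4⟩ := ih (by omega) _ f1.within_end
        (fun r hr' => by
          have : r ≠ d + 1 := by omega
          have : r ≠ d + 2 := by omega
          have : r ≠ d + 3 := by omega
          simp [*, b3 r hr'.ne, a3 r (by omega)])
        (by simp [b2, a2]) (by simp [ArithOp.eval, e1]) (by simp [ArithOp.eval, e2]; omega)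
        (by simp [b4, a4])
      refine ⟨_, ?_, τ, .loopTrue (by omega) (.seq a1 (.seq b1 (.seq c1 (.seq d1 f1)))) g1,
        g2, g3, g4⟩
      rw [Finset.sum_eq_sum_Ico_succ_bot hlt, hstep]
      omega
  obtain ⟨L, hL, τ, g1, g2, g3, g4⟩ := key m le_rfl _ h0.within_end
    (fun r hr => by
      have : r ≠ d + 2 := by omega
      simp [this, h3' r (by omega), h3 r hr])
    (by simp [h3' d (by omega), h2]) (by simp [h2']) (by simp) (by simp [h4'])
  refine ⟨_, ?_, τ, .seq h1 (.seq h1' (.seq h0 g1)), g2, g3, g4⟩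
  rw [Nat.sub_self, Nat.Ico_zero_eq_range] at hL
  omega

end Generators

/-! ### Subsets as bit masks -/

/-- The `i`-th binary digit of `x`. -/
def bit (x i : ℕ) : ℕ := x / 2 ^ i % 2

/-- The number of ones among the lowest `i` binary digits of `x`. -/
def pop (i x : ℕ) : ℕ := ∑ j ∈ Finset.range i, bit x j

/-- The subset of `Fin n` with characteristic vector `x`. -/
def maskSet (n x : ℕ) : Finset (Fin n) := {i | bit x i = 1}

theorem bit_lt_two (x i : ℕ) : bit x i < 2 := Nat.mod_lt _ two_pos

theorem bit_eq_ite {n : ℕ} (x : ℕ) (i : Fin n) :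
    bit x i = if i ∈ maskSet n x then 1 else 0 := by
  have := bit_lt_two x i
  simp only [maskSet, Finset.mem_filter, Finset.mem_univ, true_and]
  split <;> omega

theorem bit_add_two_pow_of_lt (x : ℕ) {i j : ℕ} (h : j < i) : bit (x + 2 ^ i) j = bit x j := by
  obtain ⟨k, rfl⟩ := Nat.exists_eq_add_of_lt h
  unfold bit
  rw [show 2 ^ (j + k + 1) = 2 ^ j * (2 * 2 ^ k) by ring, Nat.add_mul_div_left _ _ (by positivity),
    Nat.add_mul_mod_self_left]

theorem bit_of_lt {x i : ℕ} (h : x < 2 ^ i) : bit x i = 0 := by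
  simp [bit, Nat.div_eq_of_lt h]

theorem bit_add_two_pow_self {x i : ℕ} (h : x < 2 ^ i) : bit (x + 2 ^ i) i = 1 := by
  unfold bit
  rw [Nat.add_div_right _ (by positivity), Nat.div_eq_of_lt h]

theorem two_pow_le_of_bit {x i : ℕ} (h : bit x i = 1) : 2 ^ i ≤ x := by
  by_contra h'
  rw [bit_of_lt (not_le.1 h')] at h
  omega

theorem bit_sub_two_pow {x i : ℕ} (h : bit x i = 1) (j : ℕ) :
    bit (x - 2 ^ i) j = if j = i then 0 else bit x j := by
  obtain ⟨y, rfl⟩ := Nat.exists_eq_add_of_le' (two_pow_le_of_bit h)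
  rw [Nat.add_sub_cancel]
  have h0 : bit y i = 0 := by
    unfold bit at h ⊢
    rw [Nat.add_div_right _ (by positivity)] at h
    omega
  split
  · next hj => rw [hj, h0]
  · next hj =>
    rcases lt_or_gt_of_ne hj with hlt | hlt
    · rw [bit_add_two_pow_of_lt _ hlt]
    · obtain ⟨k, rfl⟩ := Nat.exists_eq_add_of_lt hlt
      have key : (y + 2 ^ i) / 2 ^ (i + 1) = y / 2 ^ (i + 1) := by
        rw [pow_succ, ← Nat.div_div_eq_div_mul, ← Nat.div_div_eq_div_mul,
          Nat.add_div_right _ (by positivity)]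
        unfold bit at h0
        omega
      unfold bit
      rw [show 2 ^ (i + k + 1) = 2 ^ (i + 1) * 2 ^ k by ring, ← Nat.div_div_eq_div_mul,
        ← Nat.div_div_eq_div_mul, key]

theorem eq_of_bit_eq {n x y : ℕ} (hx : x < 2 ^ n) (hy : y < 2 ^ n)
    (h : ∀ j < n, bit x j = bit y j) : x = y := by
  refine Nat.eq_of_testBit_eq fun j => ?_
  rw [Nat.testBit_eq_decide_div_mod_eq, Nat.testBit_eq_decide_div_mod_eq]
  change decide (bit x j = 1) = decide (bit y j = 1)
  rcases lt_or_ge j n with hj | hj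
  · rw [h j hj]
  · rw [bit_of_lt (hx.trans_le (Nat.pow_le_pow_right two_pos hj)),
      bit_of_lt (hy.trans_le (Nat.pow_le_pow_right two_pos hj))]

theorem pop_succ (i x : ℕ) : pop (i + 1) x = pop i x + bit x i := Finset.sum_range_succ _ _

theorem pop_mono (x : ℕ) {i j : ℕ} (h : i ≤ j) : pop i x ≤ pop j x :=
  Finset.sum_le_sum_of_subset (by simpa using h)

theorem pop_le (i x : ℕ) : pop i x ≤ i := by
  calc pop i x ≤ ∑ _j ∈ Finset.range i, 1 :=
        Finset.sum_le_sum fun j _ => Nat.le_of_lt_succ (bit_lt_two x j)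
    _ = i := by simp

theorem pop_add_two_pow (i x : ℕ) : pop i (x + 2 ^ i) = pop i x :=
  Finset.sum_congr rfl fun _ hj => bit_add_two_pow_of_lt x (Finset.mem_range.1 hj)

theorem card_maskSet (n x : ℕ) : (maskSet n x).card = pop n x := by
  rw [pop, ← Fin.sum_univ_eq_sum_range (fun j => bit x j)]
  simp only [bit_eq_ite, Finset.sum_ite_mem, Finset.univ_inter, Finset.sum_const, smul_eq_mul,
    mul_one]

theorem sum_range_two_pow_succ {M : Type*} [AddCommMonoid M] (n : ℕ) (h : ℕ → M) :
    ∑ x ∈ Finset.range (2 ^ (n + 1)), h x =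
      ∑ x ∈ Finset.range (2 ^ n), h x + ∑ x ∈ Finset.range (2 ^ n), h (x + 2 ^ n) := by
  rw [pow_succ, mul_two, Finset.sum_range_add]
  simp only [add_comm]

theorem sum_maskSet {M : Type*} [AddCommMonoid M] (n : ℕ) (h : Finset (Fin n) → M) :
    ∑ x ∈ Finset.range (2 ^ n), h (maskSet n x) = ∑ S, h S := by
  rw [← Fin.sum_univ_eq_sum_range (fun x => h (maskSet n x))]
  have hinj : Function.Injective fun x : Fin (2 ^ n) => maskSet n x := by
    intro x y hxy
    refine Fin.ext (eq_of_bit_eq x.2 y.2 fun j hj => ?_)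
    have := bit_eq_ite x.1 ⟨j, hj⟩
    have := bit_eq_ite y.1 ⟨j, hj⟩
    simp_all
  exact ((Fintype.bijective_iff_injective_and_card _).2 ⟨hinj, by simp⟩).sum_comp h

/-- Among the subsets `X` of an `n`-element set, each with all its subsets, there are `3 ^ n`
pairs. -/
theorem sum_two_pow_pop (n : ℕ) : ∑ x ∈ Finset.range (2 ^ n), 2 ^ pop n x = 3 ^ n := by
  induction n with
  | zero => simp [pop]
  | succ n ih =>
    rw [sum_range_two_pow_succ, pow_succ 3, ← ih, Finset.sum_mul, ← Finset.sum_add_distrib]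
    refine Finset.sum_congr rfl fun x hx => ?_
    have hx := Finset.mem_range.1 hx
    rw [pop_succ, pop_succ, bit_of_lt hx, bit_add_two_pow_self hx, pop_add_two_pow]
    ring

/-- The lowest `i` digits of `s` are at most those of `x`. -/
def MaskSub (i s x : ℕ) : Prop := ∀ j < i, bit s j ≤ bit x j

theorem maskSub_iff {n s x : ℕ} : MaskSub n s x ↔ maskSet n s ⊆ maskSet n x := by
  constructor
  · intro h i hi
    have h1 := h i i.2
    have h2 := bit_lt_two x i
    simp only [maskSet, Finset.mem_filter, Finset.mem_univ, true_and] at hi ⊢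
    omega
  · intro h j hj
    have := @h ⟨j, hj⟩
    have := bit_lt_two s j
    simp only [maskSet, Finset.mem_filter, Finset.mem_univ, true_and] at *
    omega

/-! ### Two ways to sum over the subsets of a set -/

/-- Distribute the lowest digits of `s` over the positions below `i` in which `x` has a one. -/
def deposit (i x s : ℕ) : ℕ := ∑ j ∈ Finset.range i, bit x j * (2 ^ j * bit s (pop j x))

theorem deposit_lt (i x s : ℕ) : deposit i x s < 2 ^ i := by
  induction i with
  | zero => simp [deposit]
  | succ i ih =>
    rw [deposit, Finset.sum_range_succ, ← deposit, pow_succ, mul_two]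
    have h1 := Nat.le_of_lt_succ (bit_lt_two x i)
    have h2 := Nat.le_of_lt_succ (bit_lt_two s (pop i x))
    have : bit x i * (2 ^ i * bit s (pop i x)) ≤ 1 * (2 ^ i * 1) := by gcongr
    omega

open Classical in
/-- As `s` runs through the numbers with `pop i x` digits, `deposit i x s` runs through the submasks
of `x`. -/
theorem sum_deposit (x i : ℕ) (g : ℕ → ℕ) :
    ∑ s ∈ Finset.range (2 ^ pop i x), g (deposit i x s) =
      ∑ s ∈ Finset.range (2 ^ i), if MaskSub i s x then g s else 0 := by
  induction i generalizing g with
  | zero => simp [pop, deposit, MaskSub]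
  | succ i ih =>
    have hlow : ∀ s < 2 ^ i, (MaskSub (i + 1) s x ↔ MaskSub i s x) := by
      intro s hs
      simp only [MaskSub, Nat.forall_lt_succ_right, bit_of_lt hs, zero_le, and_true]
    have hhigh : ∀ s < 2 ^ i,
        (MaskSub (i + 1) (s + 2 ^ i) x ↔ MaskSub i s x ∧ bit x i = 1) := by
      intro s hs
      have := bit_lt_two x i
      simp only [MaskSub, Nat.forall_lt_succ_right, bit_add_two_pow_self hs]
      refine and_congr (forall₂_congr fun j hj => ?_) (by omega)
      rw [bit_add_two_pow_of_lt _ hj]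
    rw [sum_range_two_pow_succ, pop_succ]
    rcases Nat.lt_succ_iff_lt_or_eq.1 (bit_lt_two x i) with h | h
    · have h : bit x i = 0 := by omega
      have e : ∀ s, deposit (i + 1) x s = deposit i x s := fun s => by
        rw [deposit, Finset.sum_range_succ, ← deposit, h, zero_mul, add_zero]
      have z : ∑ s ∈ Finset.range (2 ^ i),
          (if MaskSub (i + 1) (s + 2 ^ i) x then g (s + 2 ^ i) else 0) = 0 := by
        refine Finset.sum_eq_zero fun s hs => ?_
        rw [hhigh s (Finset.mem_range.1 hs), h]
        simp
      rw [h, add_zero, Finset.sum_congr rfl fun s _ => by rw [e s], ih, z, add_zero]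
      exact Finset.sum_congr rfl fun s hs => if_congr (hlow s (Finset.mem_range.1 hs)).symm rfl rfl
    · rw [h, sum_range_two_pow_succ]
      congr 1
      · rw [Finset.sum_congr rfl fun s hs => if_congr (hlow s (Finset.mem_range.1 hs)) rfl rfl,
          ← ih]
        refine Finset.sum_congr rfl fun s hs => ?_
        rw [deposit, Finset.sum_range_succ, ← deposit, bit_of_lt (Finset.mem_range.1 hs)]
        simp
      · have e : ∀ s ∈ Finset.range (2 ^ i),
            (if MaskSub (i + 1) (s + 2 ^ i) x then g (s + 2 ^ i) else 0) =
              if MaskSub i s x then g (s + 2 ^ i) else 0 := fun s hs => by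
          rw [hhigh s (Finset.mem_range.1 hs)]
          simp [h]
        rw [Finset.sum_congr rfl e, ← ih fun s => g (s + 2 ^ i)]
        refine Finset.sum_congr rfl fun s hs => ?_
        rw [deposit, Finset.sum_range_succ, bit_add_two_pow_self (Finset.mem_range.1 hs), h,
          deposit]
        congr 2
        · refine Finset.sum_congr rfl fun j hj => ?_
          have hj := Finset.mem_range.1 hj
          rcases Nat.lt_succ_iff_lt_or_eq.1 (bit_lt_two x j) with h0 | h0
          · simp [show bit x j = 0 by omega]
          · have : pop (j + 1) x ≤ pop i x := pop_mono x hj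
            rw [pop_succ] at this
            rw [bit_add_two_pow_of_lt _ (by omega)]
        · simp

/-- The first `i` rounds of the fast zeta transform of `g`: round `j` adds to the value at every mask
`x` with a one in position `j` the value at the mask in which this one is deleted. -/
def zeta (g : ℕ → ℕ) : ℕ → ℕ → ℕ
  | 0, x => g x
  | i + 1, x => zeta g i x + bit x i * zeta g i (x - 2 ^ i)

open Classical in
/-- After `i` rounds, the value at `x` is the sum over the submasks of `x` that agree with `x` in
all positions from `i` on. -/
theorem zeta_eq_sum_agree (g : ℕ → ℕ) (n i : ℕ) (hi : i ≤ n) : ∀ x < 2 ^ n, zeta g i x =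
    ∑ s ∈ Finset.range (2 ^ n),
      if (∀ j < n, bit s j ≤ bit x j ∧ (i ≤ j → bit s j = bit x j)) then g s else 0 := by
  induction i with
  | zero =>
    intro x hx
    rw [Finset.sum_eq_single x]
    · simp [zeta]
    · intro s hs hsx
      rw [if_neg]
      intro h
      exact hsx (eq_of_bit_eq (Finset.mem_range.1 hs) hx fun j hj => (h j hj).2 (Nat.zero_le j))
    · intro h
      exact absurd (Finset.mem_range.2 hx) h
  | succ i ih =>
    intro x hx
    rw [zeta, ih (by omega) x hx]
    rcases Nat.lt_succ_iff_lt_or_eq.1 (bit_lt_two x i) with h | h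
    · have h : bit x i = 0 := by omega
      rw [h, zero_mul, add_zero]
      refine Finset.sum_congr rfl fun s _ => if_congr (forall₂_congr fun j hj => ?_) rfl rfl
      rcases eq_or_ne j i with rfl | hne
      · rw [h]; constructor <;> intro h' <;> constructor <;> intros <;> omega
      · constructor <;> rintro ⟨h1, h2⟩ <;> exact ⟨h1, fun h3 => h2 (by omega)⟩
    · rw [h, one_mul, ih (by omega) _ ((Nat.sub_le x _).trans_lt hx), ← Finset.sum_add_distrib]
      refine Finset.sum_congr rfl fun s _ => ?_
      simp only [bit_sub_two_pow h]
      have hs := bit_lt_two s i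
      have h1 : (∀ j < n, bit s j ≤ bit x j ∧ (i ≤ j → bit s j = bit x j)) ↔
          (∀ j < n, bit s j ≤ bit x j ∧ (i + 1 ≤ j → bit s j = bit x j)) ∧ bit s i = 1 := by
        constructor
        · intro H
          exact ⟨fun j hj => ⟨(H j hj).1, fun h' => (H j hj).2 (by omega)⟩,
            ((H i hi).2 le_rfl).trans h⟩
        · rintro ⟨H, H'⟩ j hj
          refine ⟨(H j hj).1, fun h' => ?_⟩
          rcases eq_or_lt_of_le h' with rfl | h'
          · rw [H', h]
          · exact (H j hj).2 h'
      have h2 : (∀ j < n, bit s j ≤ (if j = i then 0 else bit x j) ∧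
            (i ≤ j → bit s j = if j = i then 0 else bit x j)) ↔
          (∀ j < n, bit s j ≤ bit x j ∧ (i + 1 ≤ j → bit s j = bit x j)) ∧ bit s i = 0 := by
        constructor
        · intro H
          have H0 : bit s i = 0 := by simpa using (H i hi).2 le_rfl
          refine ⟨fun j hj => ?_, H0⟩
          rcases eq_or_ne j i with rfl | hne
          · exact ⟨by omega, fun h' => by omega⟩
          · have := H j hj
            rw [if_neg hne] at this
            exact ⟨this.1, fun h' => this.2 (by omega)⟩
        · rintro ⟨H, H'⟩ j hj
          rcases eq_or_ne j i with rfl | hne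
          · simp [H']
          · rw [if_neg hne]
            exact ⟨(H j hj).1, fun h' => (H j hj).2 (by omega)⟩
      rw [if_congr h1 rfl rfl, if_congr h2 rfl rfl]
      by_cases hP : ∀ j < n, bit s j ≤ bit x j ∧ (i + 1 ≤ j → bit s j = bit x j)
      · rcases Nat.lt_succ_iff_lt_or_eq.1 hs with h0 | h0
        · simp [show bit s i = 0 by omega]
        · simp [h0]
      · simp only [hP, false_and, if_false, add_zero]

open Classical in
theorem zeta_eq_sum_maskSub (g : ℕ → ℕ) {n x : ℕ} (hx : x < 2 ^ n) : zeta g n x =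
    ∑ s ∈ Finset.range (2 ^ n), if MaskSub n s x then g s else 0 := by
  rw [zeta_eq_sum_agree g n n le_rfl x hx]
  refine Finset.sum_congr rfl fun s _ => if_congr (forall₂_congr fun j hj => ?_) rfl rfl
  exact ⟨fun h => h.1, fun h => ⟨h, fun h' => by omega⟩⟩

/-! ### Inclusion–exclusion for partitions -/

/-- `S` is a nonempty independent dominating set. -/
def FallClass {V : Type*} (G : SimpleGraph V) (S : Finset V) : Prop :=
  S.Nonempty ∧ G.IsIndepSet (S : Set V) ∧ G.IsDominatingSet (S : Set V)

section Cover

variable {V : Type*} [Fintype V] [DecidableEq V]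

open Classical in
/-- The sum, over the `k`-tuples of members of the family `F` that cover `V`, of `y` to the power
of the total size of the tuple. -/
noncomputable def coverSum (F : Finset V → Prop) (k y : ℕ) : ℕ :=
  ∑ p : Fin k → Finset V,
    if (∀ i, F (p i)) ∧ Finset.univ.biUnion p = Finset.univ then y ^ ∑ i, (p i).card else 0

open Classical in
/-- The generating function by size of the members of `F` that are subsets of `X`. -/
noncomputable def subsetSum (F : Finset V → Prop) (y : ℕ) (X : Finset V) : ℕ :=
  ∑ S, if S ⊆ X ∧ F S then y ^ S.card else 0

open Classical in
theorem subsetSum_pow (F : Finset V → Prop) (k y : ℕ) (X : Finset V) :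
    subsetSum F y X ^ k = ∑ p : Fin k → Finset V,
      if Finset.univ.biUnion p ⊆ X ∧ ∀ i, F (p i) then y ^ ∑ i, (p i).card else 0 := by
  rw [subsetSum, Fintype.sum_pow]
  refine Finset.sum_congr rfl fun p _ => ?_
  have hiff : Finset.univ.biUnion p ⊆ X ∧ (∀ i, F (p i)) ↔ ∀ i, p i ⊆ X ∧ F (p i) := by
    simp [forall_and]
  rw [if_congr hiff rfl rfl]
  by_cases h : ∀ i, p i ⊆ X ∧ F (p i)
  · rw [if_pos h, Finset.prod_congr rfl fun i _ => if_pos (h i), Finset.prod_pow_eq_pow_sum]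
  · rw [if_neg h]
    push Not at h
    obtain ⟨i, hi⟩ := h
    exact Finset.prod_eq_zero (Finset.mem_univ i) (if_neg fun h' => hi h'.1 h'.2)

theorem sum_neg_one_pow_card_compl (U : Finset V) :
    ∑ X : Finset V, (if U ⊆ X then (-1 : ℤ) ^ Xᶜ.card else 0) =
      if U = Finset.univ then 1 else 0 := by
  have h := Finset.sum_powerset_neg_one_pow_card (x := Uᶜ)
  rw [if_congr (Finset.compl_eq_empty_iff U) rfl rfl] at h
  rw [← h, ← Finset.sum_filter]
  refine Finset.sum_nbij' (fun X => Xᶜ) (fun X => Xᶜ) ?_ ?_ ?_ ?_ ?_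
  · intro X hX; simpa using hX
  · intro X hX; simpa [Finset.subset_compl_comm] using hX
  · intro X _; simp
  · intro X _; simp
  · intro X _; rfl

/-- Inclusion–exclusion over the set `X` in which all sets of a tuple are contained. -/
theorem sum_neg_one_pow_mul_subsetSum_pow (F : Finset V → Prop) (k y : ℕ) :
    ∑ X : Finset V, (-1 : ℤ) ^ Xᶜ.card * (subsetSum F y X : ℤ) ^ k = coverSum F k y := by
  classical
  have h : ∀ X : Finset V, (-1 : ℤ) ^ Xᶜ.card * (subsetSum F y X : ℤ) ^ k =
      ∑ p : Fin k → Finset V, (if ∀ i, F (p i) then (y : ℤ) ^ ∑ i, (p i).card else 0) *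
        if Finset.univ.biUnion p ⊆ X then (-1 : ℤ) ^ Xᶜ.card else 0 := by
    intro X
    rw [← Nat.cast_pow, subsetSum_pow, Nat.cast_sum, Finset.mul_sum]
    refine Finset.sum_congr rfl fun p _ => ?_
    by_cases h1 : Finset.univ.biUnion p ⊆ X <;> by_cases h2 : ∀ i, F (p i) <;>
      simp only [h1, h2, and_self, and_true, and_false, if_true, if_false, Nat.cast_pow,
        Nat.cast_zero, mul_zero, zero_mul, implies_true]
    ring
  rw [Finset.sum_congr rfl fun X _ => h X, Finset.sum_comm, coverSum, Nat.cast_sum]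
  refine Finset.sum_congr rfl fun p _ => ?_
  rw [← Finset.mul_sum, sum_neg_one_pow_card_compl]
  by_cases h1 : Finset.univ.biUnion p = Finset.univ <;> by_cases h2 : ∀ i, F (p i) <;>
    simp [h1, h2]

open Classical in
/-- The `k`-tuples of members of `F` that cover `V` and have total size `|V|`. -/
noncomputable def exactCovers (F : Finset V → Prop) (k : ℕ) : Finset (Fin k → Finset V) :=
  {p | (∀ i, F (p i)) ∧ Finset.univ.biUnion p = Finset.univ ∧ ∑ i, (p i).card = Fintype.card V}

theorem card_le_sum_card_of_cover {k : ℕ} {p : Fin k → Finset V}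
    (h : Finset.univ.biUnion p = Finset.univ) : Fintype.card V ≤ ∑ i, (p i).card := by
  rw [← Finset.card_univ, ← h]
  exact Finset.card_biUnion_le

/-- No cover has total size less than `|V|`, so the lowest coefficient of the cover sum, written to
the base `y`, counts the covers without overlaps. -/
theorem coverSum_div_mod (F : Finset V → Prop) (k : ℕ) {y : ℕ}
    (hy : (2 ^ Fintype.card V) ^ k < y) :
    coverSum F k y / y ^ Fintype.card V % y = (exactCovers F k).card := by
  classical
  have hpos : 0 < y := by omega
  have h1 : coverSum F k y = y ^ Fintype.card V * ∑ p : Fin k → Finset V,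
      if (∀ i, F (p i)) ∧ Finset.univ.biUnion p = Finset.univ then
        y ^ (∑ i, (p i).card - Fintype.card V) else 0 := by
    rw [coverSum, Finset.mul_sum]
    refine Finset.sum_congr rfl fun p _ => ?_
    split
    · next h => rw [← pow_add, Nat.add_sub_cancel' (card_le_sum_card_of_cover h.2)]
    · simp
  rw [h1, Nat.mul_div_cancel_left _ (by positivity), Finset.sum_nat_mod]
  have hlt : (exactCovers F k).card < y := by
    refine lt_of_le_of_lt (Finset.card_le_univ _) ?_
    simpa using hy
  have h2 : ∀ p : Fin k → Finset V,
      (if (∀ i, F (p i)) ∧ Finset.univ.biUnion p = Finset.univ then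
        y ^ (∑ i, (p i).card - Fintype.card V) else 0) % y =
      (if (∀ i, F (p i)) ∧ Finset.univ.biUnion p = Finset.univ ∧
        ∑ i, (p i).card = Fintype.card V then 1 else 0) % y := by
    intro p
    by_cases h : (∀ i, F (p i)) ∧ Finset.univ.biUnion p = Finset.univ
    · rw [if_pos h]
      have hle := card_le_sum_card_of_cover h.2
      by_cases h' : ∑ i, (p i).card = Fintype.card V
      · rw [if_pos ⟨h.1, h.2, h'⟩, h', Nat.sub_self, pow_zero]
      · rw [if_neg (fun h'' => h' h''.2.2)]
        obtain ⟨m, hm⟩ := Nat.exists_eq_add_of_lt (lt_of_le_of_ne hle (Ne.symm h'))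
        rw [hm, show Fintype.card V + m + 1 - Fintype.card V = m + 1 by omega, pow_succ,
          Nat.mul_mod_left, Nat.zero_mod]
    · rw [if_neg h, if_neg fun h' => h ⟨h'.1, h'.2.1⟩]
  rw [Finset.sum_congr rfl fun p _ => h2 p, ← Finset.sum_nat_mod, ← Finset.card_filter]
  exact Nat.mod_eq_of_lt hlt

theorem disjoint_of_sum_card_eq {k : ℕ} {p : Fin k → Finset V}
    (h : Finset.univ.biUnion p = Finset.univ) (hc : ∑ i, (p i).card = Fintype.card V)
    {i j : Fin k} (hij : i ≠ j) : Disjoint (p i) (p j) := by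
  rw [Finset.disjoint_left]
  intro v hi hj
  -- Count the pairs of a vertex and a set that contains it: every vertex occurs, and `v` twice.
  have h1 : ∑ i, (p i).card = ∑ u : V, (Finset.univ.filter fun i => u ∈ p i).card := by
    simp only [Finset.card_eq_sum_ones, Finset.sum_filter]
    rw [Finset.sum_comm]
    refine Finset.sum_congr rfl fun i _ => ?_
    simp
  have h2 : ∑ _u : V, 1 < ∑ u : V, (Finset.univ.filter fun i => u ∈ p i).card := by
    refine Finset.sum_lt_sum (fun u _ => ?_) ⟨v, Finset.mem_univ v, ?_⟩
    · have : u ∈ Finset.univ.biUnion p := h ▸ Finset.mem_univ u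
      obtain ⟨l, _, hl⟩ := Finset.mem_biUnion.1 this
      exact Finset.card_pos.2 ⟨l, by simpa using hl⟩
    · exact Finset.one_lt_card.2 ⟨i, by simpa using hi, j, by simpa using hj, hij⟩
  rw [← h1, hc] at h2
  simp at h2

theorem exactCovers_nonempty_iff (G : SimpleGraph V) (k : ℕ) :
    (exactCovers (FallClass G) k).Nonempty ↔ G.FallColorable k := by
  classical
  constructor
  · rintro ⟨p, hp⟩
    simp only [exactCovers, Finset.mem_filter, Finset.mem_univ, true_and] at hp
    obtain ⟨hF, hU, hc⟩ := hp
    have hd : ∀ i j, i ≠ j → Disjoint (p i) (p j) := fun i j h => disjoint_of_sum_card_eq hU hc h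
    have hinj : Function.Injective p := by
      intro i j hij
      by_contra hne
      have := hd i j hne
      rw [hij, disjoint_self] at this
      exact (hF j).1.ne_empty this
    refine ⟨⟨Finset.univ.image p, ?_, ?_, ?_⟩, ?_, ?_⟩
    · rw [Finset.supIndep_iff_pairwiseDisjoint]
      intro S hS T hT hST
      simp only [Finset.coe_image, Finset.coe_univ, Set.image_univ, Set.mem_range] at hS hT
      obtain ⟨i, rfl⟩ := hS
      obtain ⟨j, rfl⟩ := hT
      exact hd i j fun h => hST (h ▸ rfl)
    · rw [Finset.sup_image, Function.id_comp, Finset.sup_eq_biUnion, hU]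
    · simp only [Finset.bot_eq_empty, Finset.mem_image, Finset.mem_univ, true_and, not_exists]
      exact fun i => (hF i).1.ne_empty
    · rw [Finset.card_image_of_injective _ hinj, Finset.card_univ, Fintype.card_fin]
    · intro S hS
      obtain ⟨i, _, rfl⟩ := Finset.mem_image.1 hS
      exact (hF i).2
  · rintro ⟨P, hP, hF⟩
    let e := P.parts.equivFinOfCardEq hP
    refine ⟨fun i => (e.symm i : Finset V), ?_⟩
    simp only [exactCovers, Finset.mem_filter, Finset.mem_univ, true_and]
    refine ⟨fun i => ⟨P.nonempty_of_mem_parts (e.symm i).2, hF _ (e.symm i).2⟩, ?_, ?_⟩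
    · refine Finset.eq_univ_of_forall fun v => ?_
      obtain ⟨S, hS, hv⟩ := P.exists_mem (Finset.mem_univ v)
      exact Finset.mem_biUnion.2 ⟨e ⟨S, hS⟩, Finset.mem_univ _, by simpa using hv⟩
    · rw [← Finset.card_univ, ← P.sum_card_parts, ← Finset.sum_coe_sort P.parts]
      exact Equiv.sum_comp e.symm fun S : P.parts => (S : Finset V).card

theorem fallColorable_min_iff (G : SimpleGraph V) (k : ℕ) :
    G.FallColorable (k - (k - (Fintype.card V + 1))) ↔ G.FallColorable k := by
  rcases le_or_gt k (Fintype.card V + 1) with h | h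
  · rw [Nat.sub_eq_zero_of_le h, Nat.sub_zero]
  · have hno : ∀ l, Fintype.card V < l → ¬ G.FallColorable l := by
      rintro l hl ⟨P, hP, -⟩
      have := P.card_parts_le_card
      rw [hP, Finset.card_univ] at this
      omega
    exact iff_of_false (hno _ (by omega)) (hno _ (by omega))

end Cover

/-! ### The decision procedure -/

/-- The number of neighbours of `i` in the set with mask `s`, when `a` holds the adjacency matrix
row by row. -/
def nbrCount (n : ℕ) (a : ℕ → ℕ) (s i : ℕ) : ℕ := ∑ j ∈ Finset.range n, bit s j * a (i * n + j)

/-- A number that vanishes if and only if the set with mask `s` is nonempty, independent and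
dominating: this means that every vertex either is in the set or has neighbours in it, but
not both. -/
def defect (n : ℕ) (a : ℕ → ℕ) (s : ℕ) : ℕ :=
  ∑ i ∈ Finset.range n,
    (bit s i * nbrCount n a s i + (1 - (bit s i + nbrCount n a s i))) + (1 - s)

/-- `y` to the power of the size of the set with mask `s`, or `0` if it is not a fall class. -/
def weight (n : ℕ) (a : ℕ → ℕ) (y s : ℕ) : ℕ := (1 - defect n a s) * y ^ pop n s

/-- The sum of the `k`-th powers of `f` over the masks `x` for which `pop n x + b` is odd. -/
def paritySum (n k b : ℕ) (f : ℕ → ℕ) : ℕ :=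
  ∑ x ∈ Finset.range (2 ^ n), (pop n x + b) % 2 * f x ^ k

/-- `1` if the lowest coefficient of the alternating sum of the `k`-th powers of `f` is nonzero,
and `0` otherwise. -/
def decision (n k y : ℕ) (f : ℕ → ℕ) : ℕ :=
  1 - (1 - (paritySum n k (n + 1) f - paritySum n k n f) / y ^ n % y)

open Classical in
/-- The entries of the adjacency matrix of `G`, row by row. -/
def IsAdjMatrix {n : ℕ} (G : SimpleGraph (Fin n)) (a : ℕ → ℕ) : Prop :=
  ∀ i j : Fin n, a (i * n + j) = if G.Adj i j then 1 else 0

theorem nbrCount_eq_zero_iff {n : ℕ} {G : SimpleGraph (Fin n)} {a : ℕ → ℕ}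
    (ha : IsAdjMatrix G a) (s : ℕ) (i : Fin n) :
    nbrCount n a s i = 0 ↔ ∀ j ∈ maskSet n s, ¬ G.Adj i j := by
  rw [nbrCount, ← Fin.sum_univ_eq_sum_range (fun j => bit s j * a (i * n + j))]
  rw [Finset.sum_eq_zero_iff]
  refine ⟨fun h j hj => ?_, fun h j _ => ?_⟩
  · have := h j (Finset.mem_univ j)
    rw [bit_eq_ite, ha] at this
    simpa [hj] using this
  · rw [bit_eq_ite, ha]
    by_cases hj : j ∈ maskSet n s
    · simp [h j hj]
    · simp [hj]

theorem defect_eq_zero_iff {n : ℕ} {G : SimpleGraph (Fin n)} {a : ℕ → ℕ}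
    (ha : IsAdjMatrix G a) {s : ℕ} (hs : s < 2 ^ n) :
    defect n a s = 0 ↔ FallClass G (maskSet n s) := by
  have h1 : 1 - s = 0 ↔ (maskSet n s).Nonempty := by
    rw [Nat.sub_eq_zero_iff_le, Finset.nonempty_iff_ne_empty, Nat.one_le_iff_ne_zero, not_iff_not]
    refine ⟨fun h => by simp [h, maskSet, bit], fun h => ?_⟩
    refine eq_of_bit_eq hs (by positivity) fun j hj => ?_
    have := bit_eq_ite s ⟨j, hj⟩
    rw [h] at this
    simpa [bit] using this
  have h2 : ∀ i : Fin n, bit s i * nbrCount n a s i + (1 - (bit s i + nbrCount n a s i)) = 0 ↔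
      (i ∈ maskSet n s ↔ ∀ j ∈ maskSet n s, ¬ G.Adj i j) := by
    intro i
    rw [← nbrCount_eq_zero_iff ha, bit_eq_ite]
    by_cases hi : i ∈ maskSet n s
    · simp [hi]
    · simp [hi]; omega
  rw [defect, Nat.add_eq_zero_iff, h1, ← Fin.sum_univ_eq_sum_range
    (fun i => bit s i * nbrCount n a s i + (1 - (bit s i + nbrCount n a s i))),
    Finset.sum_eq_zero_iff, and_comm, FallClass]
  refine and_congr_right fun _ => ?_
  simp only [Finset.mem_univ, true_implies, h2]
  constructor
  · intro h
    refine ⟨fun i hi j hj _ => (h i).1 hi j hj, fun i => ?_⟩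
    by_cases hi : i ∈ maskSet n s
    · exact Or.inl hi
    · have := mt (h i).2 hi
      push Not at this
      exact Or.inr this
  · rintro ⟨hI, hD⟩ i
    refine ⟨fun hi j hj hadj => hI hi hj hadj.ne hadj, fun h => ?_⟩
    rcases hD i with hi | ⟨j, hj, hadj⟩
    · exact hi
    · exact absurd hadj (h j hj)

theorem weight_eq {n : ℕ} {G : SimpleGraph (Fin n)} {a : ℕ → ℕ} (ha : IsAdjMatrix G a) (y : ℕ)
    {s : ℕ} (hs : s < 2 ^ n) [Decidable (FallClass G (maskSet n s))] :
    weight n a y s = if FallClass G (maskSet n s) then y ^ (maskSet n s).card else 0 := by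
  rw [weight, card_maskSet]
  split
  · next h => rw [(defect_eq_zero_iff ha hs).2 h]; simp
  · next h =>
    have := mt (defect_eq_zero_iff ha hs).1 h
    rw [show 1 - defect n a s = 0 by omega, zero_mul]

open Classical in
/-- The sum of the weights of the submasks of `x`. -/
noncomputable def submaskSum (n : ℕ) (a : ℕ → ℕ) (y x : ℕ) : ℕ :=
  ∑ s ∈ Finset.range (2 ^ n), if MaskSub n s x then weight n a y s else 0

theorem submaskSum_eq {n : ℕ} {G : SimpleGraph (Fin n)} {a : ℕ → ℕ} (ha : IsAdjMatrix G a)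
    (y x : ℕ) : submaskSum n a y x = subsetSum (FallClass G) y (maskSet n x) := by
  classical
  rw [submaskSum, subsetSum, ← sum_maskSet]
  refine Finset.sum_congr rfl fun s hs => ?_
  rw [maskSub_iff, weight_eq ha y (Finset.mem_range.1 hs)]
  split_ifs <;> simp_all

theorem paritySum_succ {n : ℕ} {G : SimpleGraph (Fin n)} {a : ℕ → ℕ} (ha : IsAdjMatrix G a)
    (k y : ℕ) : paritySum n k (n + 1) (submaskSum n a y) =
      paritySum n k n (submaskSum n a y) + coverSum (FallClass G) k y := by
  zify
  rw [← sum_neg_one_pow_mul_subsetSum_pow, ← sum_maskSet, ← sub_eq_iff_eq_add', paritySum,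
    paritySum, Nat.cast_sum, Nat.cast_sum, ← Finset.sum_sub_distrib]
  refine Finset.sum_congr rfl fun x _ => ?_
  rw [submaskSum_eq ha, Nat.cast_mul, Nat.cast_mul, ← sub_mul, Nat.cast_pow,
    Finset.card_compl, Fintype.card_fin, card_maskSet]
  congr 1
  have hle := pop_le n x
  obtain ⟨m, hm⟩ := Nat.exists_eq_add_of_le hle
  rcases Nat.even_or_odd m with h | h
  · rw [show n - pop n x = m by omega, h.neg_one_pow]
    obtain ⟨l, rfl⟩ := h
    rw [show (pop n x + (n + 1)) % 2 = 1 by omega, show (pop n x + n) % 2 = 0 by omega]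
    simp
  · rw [show n - pop n x = m by omega, h.neg_one_pow]
    obtain ⟨l, rfl⟩ := h
    rw [show (pop n x + (n + 1)) % 2 = 0 by omega, show (pop n x + n) % 2 = 1 by omega]
    simp

open Classical in
theorem decision_eq {n : ℕ} {G : SimpleGraph (Fin n)} {a : ℕ → ℕ} (ha : IsAdjMatrix G a)
    (k : ℕ) {y : ℕ} (hy : (2 ^ n) ^ (k - (k - (n + 1))) < y) :
    decision n (k - (k - (n + 1))) y (submaskSum n a y) = if G.FallColorable k then 1 else 0 := by
  have h := coverSum_div_mod (FallClass G) (k - (k - (n + 1))) (y := y) (by simpa using hy)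
  rw [Fintype.card_fin] at h
  rw [decision, paritySum_succ ha, Nat.add_sub_cancel_left, h]
  have h1 := exactCovers_nonempty_iff G (k - (k - (n + 1)))
  have h2 := fallColorable_min_iff G k
  rw [Fintype.card_fin] at h2
  rw [h2, ← Finset.card_pos] at h1
  split <;> rename_i h3
  · have := h1.2 h3; omega
  · have := mt h1.1 h3; omega

/-! ### Programs for the arithmetic of masks -/

section Programs

variable {B A : ℕ} {w w' : World} {μ μ' μ'' : ℕ →₀ ℕ} {c c' : Gen} {v v' N N' : ℕ}

/-- The sum of the values of `body i` for `i` below a bound. -/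
def sumC (bound : Gen) (body : Gen → Gen) : Gen :=
  foldC bound (constC 0) fun a i => addC a (body i)

theorem Evals.sum {bound : Gen} {body : Gen → Gen} {m : ℕ} (g T : ℕ → ℕ)
    (hb : Evals B A w μ bound m N)
    (hs : ∀ i < m, ∀ w' ≥ w, ∀ x, IsAtom B A w' x i → Evals B A w' μ (body x) (g i) (T i))
    (hB : ∑ i ∈ Finset.range m, g i < 2 ^ B) :
    Evals B A w μ (sumC bound body) (∑ i ∈ Finset.range m, g i)
      (N + 4 + ∑ i ∈ Finset.range m, (T i + 9)) := by
  have h := EvalsTo.fold (body := fun a i => addC a (body i))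
    (fun j => ∑ i ∈ Finset.range j, g i) (fun _ => μ) (fun i => T i + 3)
    (isAtom_const (Nat.two_pow_pos B) μ) hb (fun i hi w' hw a x _ ha hx => by
      have hle : ∑ l ∈ Finset.range (i + 1), g l ≤ ∑ l ∈ Finset.range m, g l :=
        Finset.sum_le_sum_of_subset (by simpa using hi)
      have := (ha μ).add (hs i hi w' hw x hx) (by rw [← Finset.sum_range_succ]; omega)
      exact (this.congr (Finset.sum_range_succ _ _).symm).le (by omega))
  exact h.le (by simp only [add_assoc, Nat.reduceAdd]; omega)

/-- A sum of at most `n` terms, with a uniform bound for the cost of the terms. -/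
theorem Evals.sum_uniform {bound : Gen} {body : Gen → Gen} {m n T : ℕ} (g : ℕ → ℕ)
    (hb : Evals B A w μ bound m N) (hmn : m ≤ n)
    (hs : ∀ i < m, ∀ w' ≥ w, ∀ x, IsAtom B A w' x i → Evals B A w' μ (body x) (g i) T)
    (hB : ∑ i ∈ Finset.range m, g i < 2 ^ B) :
    Evals B A w μ (sumC bound body) (∑ i ∈ Finset.range m, g i) (N + 4 + n * (T + 9)) := by
  refine (Evals.sum g (fun _ => T) hb hs hB).le ?_
  have : m * (T + 9) ≤ n * (T + 9) := Nat.mul_le_mul_right _ hmn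
  simpa using this

/-- The power with base `b` and exponent `e`. -/
def powC (b e : Gen) : Gen := foldC e (constC 1) fun a _ => mulC a b

theorem evals_pow {b e : Gen} {vb ve : ℕ} (hb : IsAtom B A w b vb) (he : IsAtom B A w e ve)
    (hB : ∀ i ≤ ve, vb ^ i < 2 ^ B) : Evals B A w μ (powC b e) (vb ^ ve) (11 * ve + 6) := by
  have h := EvalsTo.fold (body := fun a _ => mulC a b) (fun j => vb ^ j) (fun _ => μ) (fun _ => 5)
    (isAtom_const (by simpa using hB 0 (Nat.zero_le _)) μ) (he μ)
    (fun i hi w' hw a x _ ha _ => ((ha μ).mul (hb.mono hw μ) (hB (i + 1) hi)))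
  exact h.le (by simp; omega)

theorem evals_two_pow {n vi : ℕ} {i : Gen} (hB : n + 2 ≤ B) (hi : IsAtom B A w i vi)
    (hin : vi ≤ n) : Evals B A w μ (powC (constC 2) i) (2 ^ vi) (11 * n + 6) := by
  refine (evals_pow (isAtom_const ?_) hi fun j hj => ?_).le (by omega)
  · calc 2 < 2 ^ 2 := by norm_num
      _ ≤ 2 ^ B := Nat.pow_le_pow_right two_pos (by omega)
  · exact Nat.pow_lt_pow_right one_lt_two (by omega)

/-- The remainder modulo `y`. -/
def modC (x y : Gen) : Gen := subC x (mulC (divC x y) y)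

theorem evals_mod {x y : Gen} {vx vy : ℕ} (hx : IsAtom B A w x vx) (hy : IsAtom B A w y vy)
    (hB : vx < 2 ^ B) : Evals B A w μ (modC x y) (vx % vy) 11 := by
  have h := (hx μ).sub (((hx μ).div (hy μ)).mul (hy μ)
    ((Nat.div_mul_le_self vx vy).trans_lt hB))
  refine h.congr ?_
  have := Nat.mod_add_div' vx vy
  omega

theorem isAtom_two {n : ℕ} (hB : n + 2 ≤ B) : IsAtom B A w (constC 2) 2 :=
  isAtom_const ((Nat.pow_le_pow_right two_pos (show 2 ≤ B by omega)).trans_lt'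
    (by norm_num))

theorem isAtom_one {n : ℕ} (hB : n + 2 ≤ B) : IsAtom B A w (constC 1) 1 :=
  isAtom_const (Nat.one_lt_two_pow (by omega))

/-- The program for `bit`. -/
def bitC (x i : Gen) : Gen :=
  letC (divC x (powC (constC 2) i)) fun q => modC q (constC 2)

/-- The cost of a digit at a position up to `n`. -/
def bitCost (n : ℕ) : ℕ := 11 * n + 22

theorem evals_bit {n vx vi : ℕ} {x i : Gen} (hB : n + 2 ≤ B) (hx : IsAtom B A w x vx)
    (hi : IsAtom B A w i vi) (hin : vi ≤ n) :
    Evals B A w μ (bitC x i) (bit vx vi) (bitCost n) := by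
  refine (EvalsTo.bind ((hx μ).div (evals_two_pow hB hi hin)) fun w' _ q hq hqa =>
    evals_mod hqa (isAtom_two hB) hq).le ?_
  unfold bitCost; omega

/-- The program for `pop`. -/
def popC (i x : Gen) : Gen := sumC i fun j => bitC x j

/-- The cost of counting at most `n` digits. -/
def popCost (n : ℕ) : ℕ := 6 + n * (bitCost n + 9)

theorem evals_pop {n vx vi : ℕ} {x i : Gen} (hB : n + 2 ≤ B) (hx : IsAtom B A w x vx)
    (hi : IsAtom B A w i vi) (hin : vi ≤ n) :
    Evals B A w μ (popC i x) (pop vi vx) (popCost n) := by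
  refine (Evals.sum_uniform (bit vx) (hi μ) hin (fun j hj w' hw y hy =>
    evals_bit hB (hx.mono hw) hy (by omega)) ?_).le ?_
  · have h1 := pop_le vi vx
    have h2 : n < 2 ^ B := (show n < B by omega).trans Nat.lt_two_pow_self
    exact (h1.trans hin).trans_lt h2
  · unfold popCost; omega

/-- The program for `deposit`. -/
def depositC (i x s : Gen) : Gen :=
  sumC i fun j => mulC (bitC x j) (mulC (powC (constC 2) j) (letC (popC j x) fun r => bitC s r))

/-- The cost of distributing digits over `n` positions. -/
def depositCost (n : ℕ) : ℕ := 6 + n * (2 * bitCost n + popCost n + 11 * n + 19)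

theorem evals_deposit {n vx vs : ℕ} {i x s : Gen} (hB : n + 2 ≤ B) (hi : IsAtom B A w i n)
    (hx : IsAtom B A w x vx) (hs : IsAtom B A w s vs) :
    Evals B A w μ (depositC i x s) (deposit n vx vs) (depositCost n) := by
  have hnB : 2 ^ n < 2 ^ B := Nat.pow_lt_pow_right one_lt_two (by omega)
  refine (Evals.sum_uniform (T := 2 * bitCost n + popCost n + 11 * n + 10)
    (fun j => bit vx j * (2 ^ j * bit vs (pop j vx))) (hi μ) le_rfl
    (fun j hj w' hw y hy => ?_) ?_).le ?_
  · have h1 := Nat.le_of_lt_succ (bit_lt_two vx j)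
    have h2 := Nat.le_of_lt_succ (bit_lt_two vs (pop j vx))
    have h3 : 2 ^ j ≤ 2 ^ n := Nat.pow_le_pow_right two_pos hj.le
    have h4 : 2 ^ j * bit vs (pop j vx) ≤ 2 ^ j * 1 := Nat.mul_le_mul_left _ h2
    have h5 : bit vx j * (2 ^ j * bit vs (pop j vx)) ≤ 1 * (2 ^ j * 1) := Nat.mul_le_mul h1 h4
    refine ((evals_bit hB (hx.mono hw) hy hj.le).mul ((evals_two_pow hB hy hj.le).mul
      (EvalsTo.bind (evals_pop hB (hx.mono hw) hy hj.le) fun w'' hw' r _ hr =>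
        evals_bit hB ((hs.mono hw).mono hw') hr ((pop_le j vx).trans hj.le)) ?_) ?_).le ?_
    · omega
    · omega
    · omega
  · exact (deposit_lt n vx vs).trans hnB
  · unfold depositCost; simp only [add_assoc, Nat.reduceAdd]; omega

/-! ### Programs for the generating function -/

/-- The program for `nbrCount`, on the adjacency matrix at the beginning of the memory. -/
def nbrCountC (n s i : Gen) : Gen :=
  sumC n fun j => mulC (bitC s j) (loadC (addC (mulC i n) j))

/-- The cost of counting the neighbours of a vertex. -/
def nbrCountCost (n : ℕ) : ℕ := 6 + n * (bitCost n + 19)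

/-- The first `n * n` memory cells agree with `a` and hold zeros and ones. -/
def HoldsMatrix (n : ℕ) (a : ℕ → ℕ) (μ : ℕ →₀ ℕ) : Prop := ∀ t < n * n, μ t = a t ∧ a t ≤ 1

theorem mul_add_lt_mul {n i j : ℕ} (hi : i < n) (hj : j < n) : i * n + j < n * n := by
  have : (i + 1) * n ≤ n * n := Nat.mul_le_mul_right n hi
  rw [add_mul] at this
  omega

theorem bit_mul_le_one {n i j s : ℕ} {a : ℕ → ℕ} (hμ : HoldsMatrix n a μ) (hi : i < n)
    (hj : j < n) : bit s j * a (i * n + j) ≤ 1 :=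
  Nat.mul_le_mul (Nat.le_of_lt_succ (bit_lt_two s j)) (hμ _ (mul_add_lt_mul hi hj)).2

theorem nbrCount_le {n i s : ℕ} {a : ℕ → ℕ} (hμ : HoldsMatrix n a μ) (hi : i < n) :
    nbrCount n a s i ≤ n := by
  calc nbrCount n a s i ≤ ∑ _j ∈ Finset.range n, 1 :=
        Finset.sum_le_sum fun j hj => bit_mul_le_one hμ hi (Finset.mem_range.1 hj)
    _ = n := by simp

theorem evals_nbrCount {n vs vi : ℕ} {a : ℕ → ℕ} {gn s i : Gen} (hB : (n + 1) ^ 2 + 1 ≤ B)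
    (hμ : HoldsMatrix n a μ) (hn : IsAtom B A w gn n) (hs : IsAtom B A w s vs)
    (hi : IsAtom B A w i vi) (hin : vi < n) :
    Evals B A w μ (nbrCountC gn s i) (nbrCount n a vs vi) (nbrCountCost n) := by
  have hBB : B < 2 ^ B := Nat.lt_two_pow_self
  have hsq : (n + 1) ^ 2 = n * n + 2 * n + 1 := by ring
  refine (Evals.sum_uniform (T := bitCost n + 10)
    (fun j => bit vs j * a (vi * n + j)) (hn μ) le_rfl (fun j hj w' hw y hy => ?_) ?_).le ?_
  · have hlt := mul_add_lt_mul hin hj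
    have hle := bit_mul_le_one (s := vs) hμ hin hj
    have hload : Evals B A w' μ (loadC (addC (mulC i gn) y)) (a (vi * n + j)) 9 :=
      ((((hi.mono hw μ).mul (hn.mono hw μ) (by omega)).add (hy μ) (by omega)).load).congr
        (hμ _ hlt).1
    exact ((evals_bit (by omega) (hs.mono hw) hy hj.le).mul hload (by omega)).le (by omega)
  · exact (nbrCount_le hμ hin).trans_lt (by omega)
  · unfold nbrCountCost; simp only [add_assoc, Nat.reduceAdd]; omega

/-- The program for `defect`. -/
def defectC (n s : Gen) : Gen :=
  addC (sumC n fun i => letC (bitC s i) fun b => letC (nbrCountC n s i) fun c =>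
    addC (mulC b c) (subC (constC 1) (addC b c))) (subC (constC 1) s)

/-- The cost of the program for `defect`. -/
def defectCost (n : ℕ) : ℕ := 12 + n * (bitCost n + nbrCountCost n + 27)

theorem evals_defect {n vs : ℕ} {a : ℕ → ℕ} {gn s : Gen} (hB : (n + 1) ^ 2 + 1 ≤ B)
    (hμ : HoldsMatrix n a μ) (hn : IsAtom B A w gn n) (hs : IsAtom B A w s vs) :
    Evals B A w μ (defectC gn s) (defect n a vs) (defectCost n) := by
  have hBB : B < 2 ^ B := Nat.lt_two_pow_self
  have hsq : (n + 1) ^ 2 = n * n + 2 * n + 1 := by ring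
  have hB2 : n + 2 ≤ B := by omega
  have hterm : ∀ i < n, bit vs i * nbrCount n a vs i ≤ n := by
    intro i hi
    calc _ ≤ 1 * n := Nat.mul_le_mul (Nat.le_of_lt_succ (bit_lt_two vs i)) (nbrCount_le hμ hi)
      _ = n := one_mul n
  have hsum : ∑ i ∈ Finset.range n,
      (bit vs i * nbrCount n a vs i + (1 - (bit vs i + nbrCount n a vs i))) ≤ n * n + n := by
    calc _ ≤ ∑ _i ∈ Finset.range n, (n + 1) := Finset.sum_le_sum fun i hi => by
          have := hterm i (Finset.mem_range.1 hi)
          omega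
      _ = n * n + n := by simp; ring
  have hs' := Evals.sum_uniform (T := bitCost n + nbrCountCost n + 18)
    (body := fun i => letC (bitC s i) fun b => letC (nbrCountC gn s i) fun c =>
      addC (mulC b c) (subC (constC 1) (addC b c)))
    (fun i => bit vs i * nbrCount n a vs i + (1 - (bit vs i + nbrCount n a vs i))) (hn μ) le_rfl
    (fun i hi w' hw y hy => by
      have h1 := hterm i hi
      have h2 := nbrCount_le (s := vs) hμ hi
      have h3 := bit_lt_two vs i
      refine (EvalsTo.bind (evals_bit hB2 (hs.mono hw) hy hi.le) fun w₁ hw₁ b _ hb =>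
        EvalsTo.bind (evals_nbrCount hB hμ ((hn.mono hw).mono hw₁) ((hs.mono hw).mono hw₁)
          (hy.mono hw₁) hi) fun w₂ hw₂ c _ hc =>
        ((hb.mono hw₂ μ).mul (hc μ) (by omega)).add ((isAtom_one hB2 μ).sub
          ((hb.mono hw₂ μ).add (hc μ) (by omega))) (by omega)).le ?_
      omega) (by omega)
  refine (hs'.add ((isAtom_one hB2 μ).sub (hs μ)) (by omega)).le ?_
  unfold defectCost
  rw [show bitCost n + nbrCountCost n + 18 + 9 = bitCost n + nbrCountCost n + 27 by ring]
  omega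

/-- The program for `weight`. -/
def weightC (n y s : Gen) : Gen :=
  mulC (subC (constC 1) (defectC n s)) (letC (popC n s) fun p => powC y p)

/-- The cost of the program for `weight`. -/
def weightCost (n : ℕ) : ℕ := defectCost n + popCost n + 11 * n + 12

theorem weight_le {n y s : ℕ} {a : ℕ → ℕ} (hy : 0 < y) : weight n a y s ≤ y ^ n := by
  calc weight n a y s ≤ 1 * y ^ n :=
        Nat.mul_le_mul (Nat.sub_le _ _) (Nat.pow_le_pow_right hy (pop_le n s))
    _ = y ^ n := one_mul _

theorem evals_weight {n vs vy : ℕ} {a : ℕ → ℕ} {gn y s : Gen} (hB : (n + 1) ^ 2 + 1 ≤ B)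
    (hμ : HoldsMatrix n a μ) (hy0 : 0 < vy) (hyB : ∀ i ≤ n, vy ^ i < 2 ^ B)
    (hn : IsAtom B A w gn n) (hy : IsAtom B A w y vy) (hs : IsAtom B A w s vs) :
    Evals B A w μ (weightC gn y s) (weight n a vy vs) (weightCost n) := by
  have hsq : (n + 1) ^ 2 = n * n + 2 * n + 1 := by ring
  have hB2 : n + 2 ≤ B := by omega
  have hp := pop_le n vs
  refine (((isAtom_one hB2 μ).sub (evals_defect hB hμ hn hs)).mul
    (EvalsTo.bind (evals_pop hB2 hs hn le_rfl) fun w' hw p _ hpa =>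
      (evals_pow (hy.mono hw) hpa fun i hi => hyB i (by omega)).le
        (show _ ≤ 11 * n + 6 by omega)) ?_).le ?_
  · exact (weight_le hy0).trans_lt (hyB n le_rfl)
  · unfold weightCost; omega

/-- The program for `paritySum`, where `m` is `2 ^ n`. -/
def paritySumC (n k m b : Gen) (f : Gen → Gen) : Gen :=
  sumC m fun x => letC (addC (popC n x) b) fun p =>
    mulC (modC p (constC 2)) (letC (f x) fun t => powC t k)

/-- The code `f` computes the function `F` at all masks, with cost `T`. -/
def ComputesOnMasks (B A : ℕ) (w : World) (μ : ℕ →₀ ℕ) (n : ℕ) (f : Gen → Gen) (F T : ℕ → ℕ) :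
    Prop :=
  ∀ x < 2 ^ n, ∀ w' ≥ w, ∀ g, IsAtom B A w' g x → Evals B A w' μ (f g) (F x) (T x)

theorem ComputesOnMasks.mono {n : ℕ} {f : Gen → Gen} {F T : ℕ → ℕ}
    (h : ComputesOnMasks B A w μ n f F T) (hw : w ≤ w') : ComputesOnMasks B A w' μ n f F T :=
  fun x hx w'' hw' => h x hx w'' (hw.trans hw')

/-- The cost of the program for `paritySum`. -/
def paritySumCost (n k : ℕ) (T : ℕ → ℕ) : ℕ :=
  6 + ∑ x ∈ Finset.range (2 ^ n), (T x + (popCost n + 11 * k + 34))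

theorem evals_paritySum {n k vb : ℕ} {gn gk m b : Gen} {f : Gen → Gen} {F T : ℕ → ℕ}
    (hB : (n + 1) ^ 2 + 1 ≤ B) (hvb : vb ≤ n + 1)
    (hpow : ∀ x < 2 ^ n, ∀ i ≤ k, F x ^ i < 2 ^ B) (hsum : paritySum n k vb F < 2 ^ B)
    (hn : IsAtom B A w gn n) (hk : IsAtom B A w gk k) (hm : IsAtom B A w m (2 ^ n))
    (hb : IsAtom B A w b vb) (hf : ComputesOnMasks B A w μ n f F T) :
    Evals B A w μ (paritySumC gn gk m b f) (paritySum n k vb F) (paritySumCost n k T) := by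
  have hBB : B < 2 ^ B := Nat.lt_two_pow_self
  have hsq : (n + 1) ^ 2 = n * n + 2 * n + 1 := by ring
  have hB2 : n + 2 ≤ B := by omega
  refine (Evals.sum _ (fun x => T x + (popCost n + 11 * k + 25)) (hm μ)
    (fun x hx w' hw g hg => ?_) hsum).le ?_
  · have hp := pop_le n x
    have hmod : (pop n x + vb) % 2 < 2 := Nat.mod_lt _ two_pos
    have hle : (pop n x + vb) % 2 * F x ^ k ≤ 1 * F x ^ k :=
      Nat.mul_le_mul_right _ (by omega)
    have hk' := hpow x hx k le_rfl
    refine (EvalsTo.bind ((evals_pop hB2 hg (hn.mono hw) le_rfl).add (hb.mono hw μ) (by omega))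
      fun w₁ hw₁ p hpB hp => (evals_mod hp (isAtom_two hB2) hpB).mul
        (EvalsTo.bind (hf x hx w₁ (hw.trans hw₁) g (hg.mono hw₁)) fun w₂ hw₂ t _ ht =>
          evals_pow ht (((hk.mono hw).mono hw₁).mono hw₂) (hpow x hx)) (by omega)).le ?_
    omega
  · unfold paritySumCost
    simp only [add_assoc, Nat.reduceAdd]
    omega

/-- The program for `decision`, where `m` is `2 ^ n`. -/
def decisionC (n k y m : Gen) (f : Gen → Gen) : Gen :=
  letC (divC (subC (letC (addC n (constC 1)) fun b => paritySumC n k m b f)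
    (paritySumC n k m n f)) (powC y n)) fun z =>
      subC (constC 1) (subC (constC 1) (modC z y))

/-- The cost of the program for `decision`. -/
def decisionCost (n k : ℕ) (T : ℕ → ℕ) : ℕ := 2 * paritySumCost n k T + 11 * n + 34

theorem evals_decision {n k vy : ℕ} {gn gk y m : Gen} {f : Gen → Gen} {F T : ℕ → ℕ}
    (hB : (n + 1) ^ 2 + 1 ≤ B) (hyB : ∀ i ≤ n, vy ^ i < 2 ^ B)
    (hpow : ∀ x < 2 ^ n, ∀ i ≤ k, F x ^ i < 2 ^ B) (hsum : ∀ b, paritySum n k b F < 2 ^ B)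
    (hn : IsAtom B A w gn n) (hk : IsAtom B A w gk k) (hy : IsAtom B A w y vy)
    (hm : IsAtom B A w m (2 ^ n)) (hf : ComputesOnMasks B A w μ n f F T) :
    Evals B A w μ (decisionC gn gk y m f) (decision n k vy F) (decisionCost n k T) := by
  have hBB : B < 2 ^ B := Nat.lt_two_pow_self
  have hsq : (n + 1) ^ 2 = n * n + 2 * n + 1 := by ring
  have hB2 : n + 2 ≤ B := by omega
  refine (EvalsTo.bind ((Evals.sub (EvalsTo.bind ((hn μ).add (isAtom_one hB2 μ) (by omega))
    fun w' hw b _ hb => evals_paritySum hB le_rfl hpow (hsum _) (hn.mono hw) (hk.mono hw)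
      (hm.mono hw) hb (hf.mono hw))
      (evals_paritySum hB (Nat.le_succ n) hpow (hsum _) hn hk hm hn hf)).div
      (evals_pow hy hn hyB)) fun w' hw z hzB hz =>
        (isAtom_one hB2 μ).sub ((isAtom_one hB2 μ).sub (evals_mod hz (hy.mono hw) hzB))).le ?_
  unfold decisionCost; omega

/-- Sum the weights of the submasks of `x` one by one. -/
def enumC (n y x : Gen) : Gen :=
  letC (popC n x) fun p => sumC (powC (constC 2) p) fun s =>
    letC (depositC n x s) fun t => weightC n y t

/-- The cost of summing the weights of the submasks of `x`. -/
def enumCost (n x : ℕ) : ℕ :=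
  popCost n + 11 * n + 12 + 2 ^ pop n x * (depositCost n + weightCost n + 11)

theorem evals_enum {n vy x : ℕ} {a : ℕ → ℕ} {gn y g : Gen} (hB : (n + 1) ^ 2 + 1 ≤ B)
    (hμ : HoldsMatrix n a μ) (hy0 : 0 < vy) (hyB : ∀ i ≤ n, vy ^ i < 2 ^ B)
    (hsum : submaskSum n a vy x < 2 ^ B)
    (hn : IsAtom B A w gn n) (hy : IsAtom B A w y vy) (hx : IsAtom B A w g x) :
    Evals B A w μ (enumC gn y g) (submaskSum n a vy x) (enumCost n x) := by
  have hsq : (n + 1) ^ 2 = n * n + 2 * n + 1 := by ring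
  have hB2 : n + 2 ≤ B := by omega
  rw [submaskSum, ← sum_deposit] at hsum ⊢
  refine (EvalsTo.bind (evals_pop hB2 hx hn le_rfl) fun w₁ hw₁ p _ hp =>
    Evals.sum_uniform (T := depositCost n + weightCost n + 2)
      (fun s => weight n a vy (deposit n x s)) (evals_two_pow hB2 hp (pop_le n x)) le_rfl
      (fun s _ w₂ hw₂ s' hs => ?_) hsum).le ?_
  · exact EvalsTo.bind (evals_deposit hB2 ((hn.mono hw₁).mono hw₂) ((hx.mono hw₁).mono hw₂) hs)
      fun w₃ hw₃ t _ ht => evals_weight hB hμ hy0 hyB (((hn.mono hw₁).mono hw₂).mono hw₃)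
        (((hy.mono hw₁).mono hw₂).mono hw₃) ht
  · unfold enumCost
    rw [show depositCost n + weightCost n + 2 + 9 = depositCost n + weightCost n + 11 by ring]
    omega

/-! ### The zeta transform in memory -/

/-- The memory `μ` with the values `h 0, …, h (t - 1)` stored from address `b` on. -/
noncomputable def fillMem (μ : ℕ →₀ ℕ) (b : ℕ) (h : ℕ → ℕ) : ℕ → ℕ →₀ ℕ
  | 0 => μ
  | t + 1 => (fillMem μ b h t).update (b + t) (h t)

theorem fillMem_apply (μ : ℕ →₀ ℕ) (b : ℕ) (h : ℕ → ℕ) (t a : ℕ) :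
    fillMem μ b h t a = if b ≤ a ∧ a < b + t then h (a - b) else μ a := by
  classical
  induction t with
  | zero => rw [fillMem, if_neg (by omega)]
  | succ t ih =>
    rw [fillMem, Finsupp.update_apply, ih]
    by_cases h1 : a = b + t
    · rw [if_pos h1, if_pos (by omega), h1, Nat.add_sub_cancel_left]
    · rw [if_neg h1]
      exact if_congr (by omega) rfl rfl

theorem HoldsMatrix.fillMem {n b : ℕ} {a : ℕ → ℕ} (hμ : HoldsMatrix n a μ) (hb : n * n ≤ b)
    (h : ℕ → ℕ) (t : ℕ) : HoldsMatrix n a (fillMem μ b h t) := by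
  intro i hi
  rw [fillMem_apply, if_neg (by omega)]
  exact hμ i hi

/-- Store the values of `e t`, for `t` below a bound, from a base address on. -/
def fillC (bound base : Gen) (e : Gen → Gen) : Gen :=
  foldC bound (constC 0) fun _ t => seqC (storeC (addC base t) (e t)) (constC 0)

theorem evalsTo_fill {bound base : Gen} {e : Gen → Gen} {m b T : ℕ} (h : ℕ → ℕ)
    (hbound : Evals B A w μ bound m N) (hb : IsAtom B A w base b) (hA : b + m ≤ A)
    (hAB : A ≤ 2 ^ B)
    (he : ∀ t < m, ∀ w' ≥ w, ∀ x, IsAtom B A w' x t →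
      Evals B A w' (fillMem μ b h t) (e x) (h t) T) :
    EvalsTo B A w μ (fillC bound base e) 0 (fillMem μ b h m) (N + 4 + m * (T + 14)) := by
  have h0 : 0 < 2 ^ B := Nat.two_pow_pos B
  have := EvalsTo.fold (body := fun _ t => seqC (storeC (addC base t) (e t)) (constC 0))
    (fun _ => 0) (fillMem μ b h) (fun _ => T + 8) (isAtom_const h0 _) hbound
    (fun t ht w' hw a x _ _ hx =>
      (((Evals.store ((hb.mono hw _).add (hx _) (by omega)) (he t ht w' hw x hx)
        (by omega)).seq (isAtom_const h0 _)).le (by omega)))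
  refine this.le ?_
  rw [Finset.sum_const, Finset.card_range, smul_eq_mul]
  simp only [add_assoc, Nat.reduceAdd]
  omega

/-- The memory that holds the weights from address `n * n` on, and after them all rounds of their
zeta transform, up to the first `t` values. -/
noncomputable def zetaMem (n : ℕ) (g : ℕ → ℕ) (μ : ℕ →₀ ℕ) (t : ℕ) : ℕ →₀ ℕ :=
  fillMem (fillMem μ (n * n) g (2 ^ n)) (n * n + 2 ^ n)
    (fun t => zeta g (t / 2 ^ n + 1) (t % 2 ^ n)) t

theorem zetaMem_apply (n : ℕ) (g : ℕ → ℕ) (μ : ℕ →₀ ℕ) {t u : ℕ} (hu : u < 2 ^ n + t) :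
    zetaMem n g μ t (n * n + u) = zeta g (u / 2 ^ n) (u % 2 ^ n) := by
  rw [zetaMem, fillMem_apply, fillMem_apply]
  rcases lt_or_ge u (2 ^ n) with h | h
  · rw [if_neg (by omega), if_pos (by omega), Nat.add_sub_cancel_left, Nat.div_eq_of_lt h,
      Nat.mod_eq_of_lt h, zeta]
  · obtain ⟨l, rfl⟩ := Nat.exists_eq_add_of_le h
    rw [if_pos (by omega), show n * n + (2 ^ n + l) - (n * n + 2 ^ n) = l by omega,
      Nat.add_div_left _ (Nat.two_pow_pos n), Nat.add_mod_left]

theorem zetaMem_apply_sub (g : ℕ → ℕ) (μ : ℕ →₀ ℕ) {n t i r : ℕ} (hr : r < 2 ^ n)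
    (ht : 2 ^ n * i + r = t) (h : bit r i = 1) :
    zetaMem n g μ t (n * n + t - 2 ^ i) = zeta g i (r - 2 ^ i) := by
  have hle := two_pow_le_of_bit h
  generalize 2 ^ i = c at *
  rw [show n * n + t - c = n * n + ((r - c) + 2 ^ n * i) by omega,
    zetaMem_apply n g μ (by omega), Nat.add_mul_div_left _ _ (Nat.two_pow_pos n),
    Nat.add_mul_mod_self_left, Nat.div_eq_of_lt (by omega), Nat.mod_eq_of_lt (by omega), zero_add]

/-- Store the next value of the zeta transform, at position `t` after address `q`. -/
def zetaStepC (m q t : Gen) : Gen :=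
  letC (divC t m) fun i => letC (modC t m) fun x => letC (addC q t) fun p =>
    addC (loadC p) (mulC (bitC x i) (loadC (subC p (powC (constC 2) i))))

/-- The cost of a value of the zeta transform. -/
def zetaStepCost (n : ℕ) : ℕ := bitCost n + 11 * n + 42

theorem evals_zetaStep {n t : ℕ} {g : ℕ → ℕ} {m q x : Gen} (hB : n + 2 ≤ B)
    (hz : ∀ i ≤ n, ∀ x < 2 ^ n, zeta g i x < 2 ^ B) (ht : t < n * 2 ^ n)
    (hAB : n * n + t < 2 ^ B)
    (hm : IsAtom B A w m (2 ^ n)) (hq : IsAtom B A w q (n * n)) (hx : IsAtom B A w x t) :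
    Evals B A w (zetaMem n g μ t) (zetaStepC m q x) (zeta g (t / 2 ^ n + 1) (t % 2 ^ n))
      (zetaStepCost n) := by
  have hi : t / 2 ^ n < n := Nat.div_lt_of_lt_mul (by rwa [mul_comm])
  have hr : t % 2 ^ n < 2 ^ n := Nat.mod_lt _ (Nat.two_pow_pos n)
  have hdm := Nat.div_add_mod t (2 ^ n)
  have hpow : 0 < 2 ^ n := Nat.two_pow_pos n
  have hval := hz _ hi _ hr
  rw [zeta] at hval ⊢
  -- If the digit is zero, the second cell read is irrelevant.
  have h1 : bit (t % 2 ^ n) (t / 2 ^ n) *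
      zetaMem n g μ t (n * n + t - 2 ^ (t / 2 ^ n)) = bit (t % 2 ^ n) (t / 2 ^ n) *
      zeta g (t / 2 ^ n) (t % 2 ^ n - 2 ^ (t / 2 ^ n)) := by
    rcases Nat.lt_succ_iff_lt_or_eq.1 (bit_lt_two (t % 2 ^ n) (t / 2 ^ n)) with h | h
    · rw [show bit (t % 2 ^ n) (t / 2 ^ n) = 0 by omega, zero_mul, zero_mul]
    · rw [zetaMem_apply_sub g μ hr hdm h]
  have h0 := zetaMem_apply n g μ (show t < 2 ^ n + t by omega)
  rw [← h0, ← h1] at hval ⊢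
  refine (EvalsTo.bind ((hx _).div (hm _)) fun w₁ hw₁ i _ hi' =>
    EvalsTo.bind (evals_mod (hx.mono hw₁) (hm.mono hw₁) (by omega)) fun w₂ hw₂ r _ hr' =>
    EvalsTo.bind ((((hq.mono hw₁).mono hw₂) _).add (((hx.mono hw₁).mono hw₂) _) hAB)
      fun w₃ hw₃ p _ hp => (hp _).load.add ((evals_bit hB (hr'.mono hw₃)
        ((hi'.mono hw₂).mono hw₃) hi.le).mul ((hp _).sub
          (evals_two_pow hB ((hi'.mono hw₂).mono hw₃) hi.le)).load ?_) ?_).le ?_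
  · omega
  · omega
  · unfold zetaStepCost; omega

/-- Tabulate the weights of all masks and their zeta transform, and decide with the table. -/
def tableC (n k y m : Gen) : Gen :=
  letC (mulC n n) fun q => seqC (fillC m q fun s => weightC n y s)
    (letC (addC q m) fun q' => seqC (fillC (mulC n m) q' fun t => zetaStepC m q t)
      (letC (addC q (mulC n m)) fun r => decisionC n k y m fun x => loadC (addC r x)))

/-- The cost of the program with the table. -/
def tableCost (n k : ℕ) : ℕ :=
  2 ^ n * (weightCost n + 14) + n * 2 ^ n * (zetaStepCost n + 14) +
    decisionCost n k (fun _ => 6) + 44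

theorem evalsTo_table {n k vy : ℕ} {a : ℕ → ℕ} {gn gk y m : Gen} (hB : (n + 1) ^ 2 + 1 ≤ B)
    (hμ : HoldsMatrix n a μ) (hy0 : 0 < vy) (hyB : ∀ i ≤ n, vy ^ i < 2 ^ B)
    (hA : n * n + (n + 1) * 2 ^ n ≤ A) (hAB : A < 2 ^ B)
    (hz : ∀ i ≤ n, ∀ x < 2 ^ n, zeta (weight n a vy) i x < 2 ^ B)
    (hpow : ∀ x < 2 ^ n, ∀ i ≤ k, submaskSum n a vy x ^ i < 2 ^ B)
    (hsum : ∀ b, paritySum n k b (submaskSum n a vy) < 2 ^ B)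
    (hn : IsAtom B A w gn n) (hk : IsAtom B A w gk k) (hy : IsAtom B A w y vy)
    (hm : IsAtom B A w m (2 ^ n)) :
    EvalsTo B A w μ (tableC gn gk y m) (decision n k vy (submaskSum n a vy))
      (zetaMem n (weight n a vy) μ (n * 2 ^ n)) (tableCost n k) := by
  have hsq : (n + 1) ^ 2 = n * n + 2 * n + 1 := by ring
  have hB2 : n + 2 ≤ B := by omega
  have hpos : 0 < 2 ^ n := Nat.two_pow_pos n
  have hA' : n * n + 2 ^ n + n * 2 ^ n ≤ A := by rw [add_mul, one_mul] at hA; omega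
  refine (EvalsTo.bind ((hn μ).mul (hn μ) (by omega)) fun w₁ hw₁ q _ hq => EvalsTo.seq
    (evalsTo_fill (weight n a vy) (hm.mono hw₁ μ) hq (by omega) hAB.le fun s _ w₂ hw₂ x hx =>
      evals_weight hB (hμ.fillMem le_rfl _ _) hy0 hyB ((hn.mono hw₁).mono hw₂)
        ((hy.mono hw₁).mono hw₂) hx)
    (EvalsTo.bind ((hq _).add (hm.mono hw₁ _) (by omega)) fun w₂ hw₂ q' _ hq' => EvalsTo.seq
      (evalsTo_fill (fun t => zeta (weight n a vy) (t / 2 ^ n + 1) (t % 2 ^ n))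
        (((hn.mono hw₁).mono hw₂ _).mul ((hm.mono hw₁).mono hw₂ _) (by omega)) hq' hA' hAB.le
        fun t ht w₃ hw₃ x hx => evals_zetaStep hB2 hz ht (by omega)
          (((hm.mono hw₁).mono hw₂).mono hw₃) ((hq.mono hw₂).mono hw₃) hx)
      (EvalsTo.bind ((hq.mono hw₂ _).add (((hn.mono hw₁).mono hw₂ _).mul
        ((hm.mono hw₁).mono hw₂ _) (by omega)) (by omega)) fun w₃ hw₃ r _ hr =>
          evals_decision hB hyB hpow hsum (((hn.mono hw₁).mono hw₂).mono hw₃)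
            (((hk.mono hw₁).mono hw₂).mono hw₃) (((hy.mono hw₁).mono hw₂).mono hw₃)
            (((hm.mono hw₁).mono hw₂).mono hw₃) (T := fun _ => 6)
            fun x hx w₄ hw₄ g hg => ?_))).le ?_
  · refine (((hr.mono hw₄ _).add (hg _) (by omega)).load).congr ?_
    rw [add_assoc, ← zetaMem, zetaMem_apply n _ μ (by omega), mul_comm n,
      Nat.mul_add_div hpos, Nat.mul_add_mod, Nat.div_eq_of_lt hx, Nat.mod_eq_of_lt hx, add_zero,
      zeta_eq_sum_maskSub _ hx, submaskSum]
  · unfold tableCost; omega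

end Programs

/-! ### Running a code generator on a graph -/

theorem graphInput_reg {n : ℕ} (G : SimpleGraph (Fin n)) (k r : ℕ) :
    (graphInput G k).reg r = if r = 0 then n else if r = 1 then k else 0 := by
  rcases r with _ | _ | r <;> simp [graphInput]

theorem isAdjMatrix_graphInput {n : ℕ} (G : SimpleGraph (Fin n)) (k : ℕ) :
    IsAdjMatrix G (graphInput G k).mem := by
  classical
  intro i j
  have hinj : ∀ i' j' : Fin n, (i' : ℕ) * n + j' = i * n + j → i' = i ∧ j' = j := by
    intro i' j' h
    have hn : 0 < n := i.pos
    have h1 := congrArg (· / n) h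
    have h2 := congrArg (· % n) h
    simp only [mul_comm _ n, Nat.mul_add_div hn, Nat.mul_add_mod, Nat.div_eq_of_lt j.2,
      Nat.div_eq_of_lt j'.2, Nat.mod_eq_of_lt j.2, Nat.mod_eq_of_lt j'.2, add_zero] at h1 h2
    exact ⟨Fin.ext h1, Fin.ext h2⟩
  simp only [graphInput, Finsupp.finsetSum_apply, Finsupp.single_apply]
  rw [Finset.sum_eq_single i, Finset.sum_eq_single j]
  · simp
  · intro j' _ hne
    rw [if_neg fun h => hne (hinj _ _ h).2]
  · simp
  · intro i' _ hne
    exact Finset.sum_eq_zero fun j' _ => if_neg fun h => hne (hinj _ _ h).1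
  · simp

theorem graphInput_mem_eq_zero {n : ℕ} (G : SimpleGraph (Fin n)) (k : ℕ) {t : ℕ}
    (ht : n * n ≤ t) : (graphInput G k).mem t = 0 := by
  classical
  simp only [graphInput, Finsupp.finsetSum_apply, Finsupp.single_apply]
  refine Finset.sum_eq_zero fun i _ => Finset.sum_eq_zero fun j _ => if_neg fun h => ?_
  have := mul_add_lt_mul i.2 j.2
  omega

theorem holdsMatrix_graphInput {n : ℕ} (G : SimpleGraph (Fin n)) (k : ℕ) :
    HoldsMatrix n (graphInput G k).mem (graphInput G k).mem := by
  intro t ht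
  have hn : 0 < n := by
    rcases Nat.eq_zero_or_pos n with rfl | h
    · omega
    · exact h
  have := isAdjMatrix_graphInput G k ⟨t / n, Nat.div_lt_of_lt_mul ht⟩ ⟨t % n, Nat.mod_lt _ hn⟩
  rw [Nat.div_add_mod'] at this
  refine ⟨rfl, ?_⟩
  rw [this]
  split <;> omega

theorem within_graphInput {n k B A : ℕ} (G : SimpleGraph (Fin n)) (hn : n < 2 ^ B)
    (hk : k < 2 ^ B) (hB : 1 < 2 ^ B) (hA : n * n ≤ A) : Within B A (graphInput G k) where
  reg_lt r := by
    rw [graphInput_reg]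
    split_ifs <;> omega
  mem_lt a := by
    rcases lt_or_ge a (n * n) with h | h
    · exact (holdsMatrix_graphInput G k a h).2.trans_lt hB
    · rw [graphInput_mem_eq_zero G k h]
      omega
  mem_eq a ha := graphInput_mem_eq_zero G k (hA.trans ha)

theorem SolvesFallColoring.mono {p : Prog} {T S T' S' : ℕ → ℕ → ℕ}
    (h : SolvesFallColoring p T S) (hT : ∀ n k, T n k ≤ T' n k) (hS : ∀ n k, S n k ≤ S' n k) :
    SolvesFallColoring p T' S' := fun n k G => by
  obtain ⟨t, s, τ, he, hv, ht, hs⟩ := h n k G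
  exact ⟨t, s, τ, he, hv, ht.trans (hT n k), hs.trans (hS n k)⟩

/-- The world of the inputs: the registers `0` and `1` contain `n` and `k`. -/
noncomputable def inputWorld {n : ℕ} (G : SimpleGraph (Fin n)) (k : ℕ) : World where
  depth := 2
  reg := (graphInput G k).reg

theorem isAtom_inputWorld_zero {B A n : ℕ} (G : SimpleGraph (Fin n)) (k : ℕ) :
    IsAtom B A (inputWorld G k) (varC 0) n := by
  have h := isAtom_var (B := B) (A := A) (w := inputWorld G k) (r := 0) (by simp [inputWorld])
  have e : (inputWorld G k).reg 0 = n := graphInput_reg G k 0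
  rwa [e] at h

theorem isAtom_inputWorld_one {B A n : ℕ} (G : SimpleGraph (Fin n)) (k : ℕ) :
    IsAtom B A (inputWorld G k) (varC 1) k := by
  have h := isAtom_var (B := B) (A := A) (w := inputWorld G k) (r := 1) (by simp [inputWorld])
  have e : (inputWorld G k).reg 1 = k := graphInput_reg G k 1
  rwa [e] at h

open Classical in
/-- A code generator that decides fall colorability yields a program whose time and space are
governed by the number of steps, the word length and the number of cells. -/
theorem exists_solvesFallColoring (c : Gen) (B A N : ℕ → ℕ → ℕ)
    (hnB : ∀ n k, n + 2 ≤ B n k) (hkB : ∀ n k, Nat.size k ≤ B n k)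
    (hA : ∀ n k, n * n ≤ A n k) (hAB : ∀ n k, A n k ≤ 2 ^ B n k)
    (h : ∀ n k (G : SimpleGraph (Fin n)), ∃ μ, EvalsTo (B n k) (A n k) (inputWorld G k)
      (graphInput G k).mem c (if G.FallColorable k then 1 else 0) μ (N n k)) :
    ∃ p R, SolvesFallColoring p (fun n k => (N n k + 2) * (1 + 2 * B n k))
      (fun n k => R * B n k + A n k * (2 * B n k)) := by
  obtain ⟨R, hR⟩ := Prog.exists_writesBelow (.seq (c 2) (move 0 2))
  refine ⟨.seq (c 2) (move 0 2), max R 2, fun n k G => ?_⟩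
  obtain ⟨μ, hμ⟩ := h n k G
  have hBB : B n k < 2 ^ B n k := Nat.lt_two_pow_self
  have := hnB n k
  have hin := within_graphInput G (by omega) (Nat.size_le.1 (hkB n k)) (by omega) (hA n k)
  obtain ⟨M, hM, τ, h1, h2, _, _⟩ := hμ 2 _ le_rfl hin (fun _ _ => rfl) rfl
  obtain ⟨τ', h1', h2', _, _⟩ := run_move h1.within_end (r := 0) (s := 2) (by omega)
  have hreg : RegsBelow (max R 2) (graphInput G k) := by
    intro r hr
    have := (le_max_right R 2).trans hr
    rw [graphInput_reg, if_neg (by omega), if_neg (by omega)]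
  obtain ⟨_, t, s, he, ht, hs⟩ := (Run.seq h1 h1').exec (hAB n k) (hR.mono (le_max_left R 2)) hreg
  exact ⟨t, s, τ', he, h2'.trans h2, ht.trans (Nat.mul_le_mul_right _ (by omega)), hs⟩

/-! ### Word length and common setup -/

/-- The base of the number system in which the cover sums are read off. -/
def weightBase (n : ℕ) : ℕ := 2 ^ ((n + 1) * (n + 1))

/-- A word length that suffices for all numbers in the computations. -/
def wordLength (n k : ℕ) : ℕ :=
  (n + 1) * (n + 1) * ((n + 1) * (n + 1) + 1) + 2 + Nat.size k

theorem le_wordLength (n k : ℕ) : (n + 1) * (n + 1) + 2 ≤ wordLength n k := by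
  have : (n + 1) * (n + 1) * 1 ≤ (n + 1) * (n + 1) * ((n + 1) * (n + 1) + 1) :=
    Nat.mul_le_mul_left _ (by omega)
  unfold wordLength
  omega

theorem weightBase_pos (n : ℕ) : 0 < weightBase n := Nat.two_pow_pos _

theorem weightBase_pow_lt {n k j : ℕ} (hj : j ≤ (n + 1) * (n + 1) + 1) :
    weightBase n ^ j < 2 ^ wordLength n k := by
  rw [weightBase, ← pow_mul]
  refine Nat.pow_lt_pow_right one_lt_two ?_
  have : (n + 1) * (n + 1) * j ≤ (n + 1) * (n + 1) * ((n + 1) * (n + 1) + 1) :=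
    Nat.mul_le_mul_left _ hj
  unfold wordLength
  omega

theorem two_pow_le_weightBase (n : ℕ) : 2 ^ n ≤ weightBase n :=
  Nat.pow_le_pow_right two_pos (by nlinarith)

theorem sum_weight_le {n : ℕ} (a : ℕ → ℕ) (P : ℕ → Prop) [DecidablePred P] :
    ∑ s ∈ Finset.range (2 ^ n), (if P s then weight n a (weightBase n) s else 0) ≤
      weightBase n ^ (n + 1) := by
  calc _ ≤ ∑ _s ∈ Finset.range (2 ^ n), weightBase n ^ n := by
        refine Finset.sum_le_sum fun s _ => ?_
        split
        · exact weight_le (weightBase_pos n)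
        · exact Nat.zero_le _
    _ = 2 ^ n * weightBase n ^ n := by simp
    _ ≤ weightBase n * weightBase n ^ n := Nat.mul_le_mul_right _ (two_pow_le_weightBase n)
    _ = weightBase n ^ (n + 1) := (pow_succ' _ _).symm

theorem submaskSum_pow_le {n i : ℕ} (a : ℕ → ℕ) (x : ℕ) (hi : i ≤ n + 1) :
    submaskSum n a (weightBase n) x ^ i ≤ weightBase n ^ ((n + 1) * (n + 1)) := by
  classical
  calc _ ≤ (weightBase n ^ (n + 1)) ^ i := Nat.pow_le_pow_left (sum_weight_le a _) i
    _ = weightBase n ^ ((n + 1) * i) := (pow_mul _ _ _).symm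
    _ ≤ _ := Nat.pow_le_pow_right (weightBase_pos n) (Nat.mul_le_mul_left _ hi)

theorem paritySum_le {n k : ℕ} (a : ℕ → ℕ) (b : ℕ) (hk : k ≤ n + 1) :
    paritySum n k b (submaskSum n a (weightBase n)) ≤
      weightBase n ^ ((n + 1) * (n + 1) + 1) := by
  calc _ ≤ ∑ _x ∈ Finset.range (2 ^ n), weightBase n ^ ((n + 1) * (n + 1)) := by
        refine Finset.sum_le_sum fun x _ => ?_
        have h1 : (pop n x + b) % 2 ≤ 1 := Nat.le_of_lt_succ (Nat.mod_lt _ two_pos)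
        exact (Nat.mul_le_mul h1 (submaskSum_pow_le a x hk)).trans_eq (one_mul _)
    _ = 2 ^ n * weightBase n ^ ((n + 1) * (n + 1)) := by simp
    _ ≤ weightBase n * weightBase n ^ ((n + 1) * (n + 1)) :=
        Nat.mul_le_mul_right _ (two_pow_le_weightBase n)
    _ = _ := (pow_succ' _ _).symm

theorem two_pow_pow_lt_weightBase {n k : ℕ} (hk : k ≤ n + 1) : (2 ^ n) ^ k < weightBase n := by
  rw [← pow_mul, weightBase]
  refine Nat.pow_lt_pow_right one_lt_two ?_
  have : n * k ≤ n * (n + 1) := Nat.mul_le_mul_left n hk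
  nlinarith

/-- Compute the base of the number system, `2 ^ n` and the minimum of `k` and `n + 1`. The minimum
keeps powers with exponent `k` of polynomial length. -/
def setupC (n k : Gen) (body : Gen → Gen → Gen → Gen) : Gen :=
  letC (addC n (constC 1)) fun l => letC (mulC l l) fun e => letC (powC (constC 2) e) fun y =>
    letC (powC (constC 2) n) fun m => letC (subC k (subC k l)) fun k' => body y m k'

theorem evalsTo_setup {A n k v N : ℕ} {w : World} {μ μ' : ℕ →₀ ℕ} {gn gk : Gen}
    {body : Gen → Gen → Gen → Gen} (hn : IsAtom (wordLength n k) A w gn n)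
    (hk : IsAtom (wordLength n k) A w gk k)
    (h : ∀ w' ≥ w, ∀ y m k', IsAtom (wordLength n k) A w' y (weightBase n) →
      IsAtom (wordLength n k) A w' m (2 ^ n) →
      IsAtom (wordLength n k) A w' k' (k - (k - (n + 1))) →
      EvalsTo (wordLength n k) A w' μ (body y m k') v μ' N) :
    EvalsTo (wordLength n k) A w μ (setupC gn gk body) v μ'
      (N + 11 * ((n + 1) * (n + 1)) + 11 * n + 40) := by
  have hB := le_wordLength n k
  have hBB : wordLength n k < 2 ^ wordLength n k := Nat.lt_two_pow_self
  have hsq : (n + 1) * (n + 1) = n * n + 2 * n + 1 := by ring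
  have hB2 : n + 2 ≤ wordLength n k := by omega
  refine (EvalsTo.bind ((hn μ).add (isAtom_one hB2 μ) (by omega)) fun w₁ hw₁ l _ hl =>
    EvalsTo.bind ((hl μ).mul (hl μ) (by omega)) fun w₂ hw₂ e _ he =>
    EvalsTo.bind (evals_two_pow hB he le_rfl) fun w₃ hw₃ y _ hy =>
    EvalsTo.bind (evals_two_pow hB2 (((hn.mono hw₁).mono hw₂).mono hw₃) le_rfl)
      fun w₄ hw₄ m _ hm =>
    EvalsTo.bind (((((hk.mono hw₁).mono hw₂).mono hw₃).mono hw₄ μ).sub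
      (((((hk.mono hw₁).mono hw₂).mono hw₃).mono hw₄ μ).sub
        (((hl.mono hw₂).mono hw₃).mono hw₄ μ))) fun w₅ hw₅ k' _ hk' =>
    h w₅ ((((hw₁.trans hw₂).trans hw₃).trans hw₄).trans hw₅) y m k' ((hy.mono hw₄).mono hw₅)
      (hm.mono hw₅) hk').le ?_
  omega

/-! ### Polynomial bounds -/

/-- The function is bounded by a polynomial in `n` and the length of `k`. -/
def PolyBounded (f : ℕ → ℕ → ℕ) : Prop :=
  ∃ P : Polynomial ℕ, ∀ n k, f n k ≤ P.eval (n + Nat.size k)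

theorem PolyBounded.const (c : ℕ) : PolyBounded fun _ _ => c :=
  ⟨Polynomial.C c, fun _ _ => by simp⟩

theorem PolyBounded.vertices : PolyBounded fun n _ => n := ⟨Polynomial.X, fun _ _ => by simp⟩

theorem PolyBounded.size : PolyBounded fun _ k => Nat.size k :=
  ⟨Polynomial.X, fun _ _ => by simp⟩

theorem PolyBounded.add {f g : ℕ → ℕ → ℕ} (hf : PolyBounded f) (hg : PolyBounded g) :
    PolyBounded fun n k => f n k + g n k := by
  obtain ⟨P, hP⟩ := hf
  obtain ⟨Q, hQ⟩ := hg
  exact ⟨P + Q, fun n k => by rw [Polynomial.eval_add]; exact add_le_add (hP n k) (hQ n k)⟩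

theorem PolyBounded.mul {f g : ℕ → ℕ → ℕ} (hf : PolyBounded f) (hg : PolyBounded g) :
    PolyBounded fun n k => f n k * g n k := by
  obtain ⟨P, hP⟩ := hf
  obtain ⟨Q, hQ⟩ := hg
  exact ⟨P * Q, fun n k => by rw [Polynomial.eval_mul]; exact Nat.mul_le_mul (hP n k) (hQ n k)⟩

theorem polyBounded_wordLength : PolyBounded wordLength := by
  unfold wordLength
  repeat' first
    | exact PolyBounded.const _ | exact PolyBounded.vertices | exact PolyBounded.size
    | apply PolyBounded.add | apply PolyBounded.mul

theorem polyBounded_popCost : PolyBounded fun n _ => popCost n := by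
  unfold popCost bitCost
  repeat' first
    | exact PolyBounded.const _ | exact PolyBounded.vertices
    | apply PolyBounded.add | apply PolyBounded.mul

theorem polyBounded_depositCost : PolyBounded fun n _ => depositCost n := by
  unfold depositCost bitCost
  repeat' first
    | exact PolyBounded.const _ | exact PolyBounded.vertices | exact polyBounded_popCost
    | apply PolyBounded.add | apply PolyBounded.mul

theorem polyBounded_weightCost : PolyBounded fun n _ => weightCost n := by
  unfold weightCost defectCost nbrCountCost bitCost
  repeat' first
    | exact PolyBounded.const _ | exact PolyBounded.vertices | exact polyBounded_popCost
    | apply PolyBounded.add | apply PolyBounded.mul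

theorem polyBounded_zetaStepCost : PolyBounded fun n _ => zetaStepCost n := by
  unfold zetaStepCost bitCost
  repeat' first
    | exact PolyBounded.const _ | exact PolyBounded.vertices
    | apply PolyBounded.add | apply PolyBounded.mul

/-! ### The two algorithms -/

/-- Enumerating all pairs `S ⊆ X` takes time `3 ^ n` up to a polynomial factor. -/
theorem decisionCost_enumCost_le {n k : ℕ} (hk : k ≤ n + 1) :
    decisionCost n k (enumCost n) ≤ 3 ^ n * (12 + 2 * (popCost n + 11 * n + 12 +
      (depositCost n + weightCost n + 11) + (popCost n + 11 * (n + 1) + 34)) + 11 * n + 34) := by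
  have h23 : 2 ^ n ≤ 3 ^ n := Nat.pow_le_pow_left (by omega) n
  have h1 : 1 ≤ 3 ^ n := Nat.one_le_pow _ _ (by omega)
  have hsum : ∑ x ∈ Finset.range (2 ^ n), (enumCost n x + (popCost n + 11 * k + 34)) =
      2 ^ n * (popCost n + 11 * n + 12 + (popCost n + 11 * k + 34)) +
        3 ^ n * (depositCost n + weightCost n + 11) := by
    simp only [enumCost, Finset.sum_add_distrib, ← Finset.sum_mul, sum_two_pow_pop,
      Finset.sum_const, Finset.card_range, smul_eq_mul]
    ring
  have hle : 2 ^ n * (popCost n + 11 * n + 12 + (popCost n + 11 * k + 34)) ≤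
      3 ^ n * (popCost n + 11 * n + 12 + (popCost n + 11 * (n + 1) + 34)) :=
    Nat.mul_le_mul h23 (by omega)
  have hle' : 1 * (12 + 11 * n + 34) ≤ 3 ^ n * (12 + 11 * n + 34) := Nat.mul_le_mul_right _ h1
  unfold decisionCost paritySumCost
  rw [hsum]
  calc _ = 1 * (12 + 11 * n + 34) + 2 * (2 ^ n * (popCost n + 11 * n + 12 +
        (popCost n + 11 * k + 34)) + 3 ^ n * (depositCost n + weightCost n + 11)) := by ring
    _ ≤ 3 ^ n * (12 + 11 * n + 34) + 2 * (3 ^ n * (popCost n + 11 * n + 12 +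
        (popCost n + 11 * (n + 1) + 34)) + 3 ^ n * (depositCost n + weightCost n + 11)) := by
      omega
    _ = _ := by ring

theorem tableCost_le {n k : ℕ} (hk : k ≤ n + 1) :
    tableCost n k ≤ 2 ^ n * (weightCost n + 14 + n * (zetaStepCost n + 14) +
      2 * (6 + (popCost n + 11 * (n + 1) + 34)) + 11 * n + 90) := by
  have h1 : 1 ≤ 2 ^ n := Nat.one_le_two_pow
  have hle : 2 ^ n * (6 + (popCost n + 11 * k + 34)) ≤
      2 ^ n * (6 + (popCost n + 11 * (n + 1) + 34)) := Nat.mul_le_mul_left _ (by omega)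
  have hle' : 1 * (11 * n + 90) ≤ 2 ^ n * (11 * n + 90) := Nat.mul_le_mul_right _ h1
  unfold tableCost decisionCost paritySumCost
  rw [Finset.sum_const, Finset.card_range, smul_eq_mul]
  calc _ = 2 ^ n * (weightCost n + 14) + 2 ^ n * (n * (zetaStepCost n + 14)) +
        2 * (2 ^ n * (6 + (popCost n + 11 * k + 34))) + 1 * (11 * n + 90) := by ring
    _ ≤ 2 ^ n * (weightCost n + 14) + 2 ^ n * (n * (zetaStepCost n + 14)) +
        2 * (2 ^ n * (6 + (popCost n + 11 * (n + 1) + 34))) + 2 ^ n * (11 * n + 90) := by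
      omega
    _ = _ := by ring

theorem exists_solves_polynomial_space :
    ∃ (p : Prog) (P Q : Polynomial ℕ), SolvesFallColoring p
      (fun n k => 3 ^ n * P.eval (n + Nat.size k)) (fun n k => Q.eval (n + Nat.size k)) := by
  let C : ℕ → ℕ → ℕ := fun n _ => 12 + 2 * (popCost n + 11 * n + 12 +
      (depositCost n + weightCost n + 11) + (popCost n + 11 * (n + 1) + 34)) + 11 * n + 34 +
      11 * ((n + 1) * (n + 1)) + 11 * n + 42
  obtain ⟨p, R, hp⟩ := exists_solvesFallColoring
    (setupC (varC 0) (varC 1) fun y m k => decisionC (varC 0) k y m (enumC (varC 0) y))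
    wordLength (fun n _ => n * n)
    (fun n k => decisionCost n (k - (k - (n + 1))) (enumCost n) +
      11 * ((n + 1) * (n + 1)) + 11 * n + 40)
    (fun n k => by have := le_wordLength n k; nlinarith)
    (fun n k => by unfold wordLength; omega) (fun _ _ => le_rfl)
    (fun n k => by
      have := le_wordLength n k
      have : wordLength n k < 2 ^ wordLength n k := Nat.lt_two_pow_self
      nlinarith)
    (fun n k G => by
      have hB : (n + 1) ^ 2 + 1 ≤ wordLength n k := by
        have := le_wordLength n k
        rw [sq]; omega
      have hk : k - (k - (n + 1)) ≤ n + 1 := by omega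
      have hyB : ∀ i ≤ n, weightBase n ^ i < 2 ^ wordLength n k := fun i hi =>
        weightBase_pow_lt (by nlinarith)
      rw [← decision_eq (isAdjMatrix_graphInput G k) k (two_pow_pow_lt_weightBase hk)]
      refine ⟨(graphInput G k).mem, evalsTo_setup (isAtom_inputWorld_zero G k)
        (isAtom_inputWorld_one G k) fun w hw y m k' hy hm hk' => evals_decision hB hyB ?_ ?_
          ((isAtom_inputWorld_zero G k).mono hw) hk' hy hm ?_⟩
      · exact fun x _ i hi => (submaskSum_pow_le _ x (hi.trans hk)).trans_lt
          (weightBase_pow_lt (by omega))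
      · exact fun b => (paritySum_le _ b hk).trans_lt (weightBase_pow_lt le_rfl)
      · intro x _ w' hw' g hg
        refine evals_enum hB (holdsMatrix_graphInput G k) (weightBase_pos n) hyB ?_
          (((isAtom_inputWorld_zero G k).mono hw).mono hw') (hy.mono hw') hg
        have := submaskSum_pow_le (n := n) (i := 1) (graphInput G k).mem x (by omega)
        rw [pow_one] at this
        exact this.trans_lt (weightBase_pow_lt (by omega)))
  have hT : PolyBounded fun n k => C n k * (1 + 2 * wordLength n k) := by
    repeat' first
      | exact PolyBounded.const _ | exact PolyBounded.vertices | exact polyBounded_wordLength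
      | exact polyBounded_popCost | exact polyBounded_depositCost | exact polyBounded_weightCost
      | apply PolyBounded.add | apply PolyBounded.mul
  have hS : PolyBounded fun n k => R * wordLength n k + n * n * (2 * wordLength n k) := by
    repeat' first
      | exact PolyBounded.const _ | exact PolyBounded.vertices | exact polyBounded_wordLength
      | apply PolyBounded.add | apply PolyBounded.mul
  obtain ⟨P, hP⟩ := hT
  obtain ⟨Q, hQ⟩ := hS
  refine ⟨p, P, Q, hp.mono (fun n k => ?_) hQ⟩
  refine le_trans ?_ (Nat.mul_le_mul_left (3 ^ n) (hP n k))
  rw [← mul_assoc (3 ^ n)]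
  refine Nat.mul_le_mul_right _ ?_
  have h1 := decisionCost_enumCost_le (n := n) (k := k - (k - (n + 1))) (by omega)
  have h2 : 1 * (11 * ((n + 1) * (n + 1)) + 11 * n + 42) ≤
      3 ^ n * (11 * ((n + 1) * (n + 1)) + 11 * n + 42) :=
    Nat.mul_le_mul_right _ (Nat.one_le_pow _ _ (by omega))
  calc _ = decisionCost n (k - (k - (n + 1))) (enumCost n) +
        1 * (11 * ((n + 1) * (n + 1)) + 11 * n + 42) := by ring
    _ ≤ _ := add_le_add h1 h2
    _ = _ := by simp only [C]; ring

theorem tableSize_lt (n k : ℕ) : n * n + (n + 1) * 2 ^ n < 2 ^ wordLength n k := by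
  have h1 : n < 2 ^ n := Nat.lt_two_pow_self
  have h2 : n * n ≤ 2 ^ n * 2 ^ n := Nat.mul_le_mul h1.le h1.le
  have h3 : (n + 1) * 2 ^ n ≤ 2 ^ n * 2 ^ n := Nat.mul_le_mul_right _ h1
  calc _ ≤ 2 ^ n * 2 ^ n + 2 ^ n * 2 ^ n := add_le_add h2 h3
    _ = 2 ^ (n + n + 1) := by ring
    _ < _ := Nat.pow_lt_pow_right one_lt_two (by have := le_wordLength n k; nlinarith)

theorem exists_solves_exponential_space :
    ∃ (p : Prog) (P Q : Polynomial ℕ), SolvesFallColoring p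
      (fun n k => 2 ^ n * P.eval (n + Nat.size k))
      (fun n k => 2 ^ n * Q.eval (n + Nat.size k)) := by
  let C : ℕ → ℕ → ℕ := fun n _ => weightCost n + 14 + n * (zetaStepCost n + 14) +
      2 * (6 + (popCost n + 11 * (n + 1) + 34)) + 11 * n + 90 +
      (11 * ((n + 1) * (n + 1)) + 11 * n + 42)
  obtain ⟨p, R, hp⟩ := exists_solvesFallColoring
    (setupC (varC 0) (varC 1) fun y m k => tableC (varC 0) k y m)
    wordLength (fun n _ => n * n + (n + 1) * 2 ^ n)
    (fun n k => tableCost n (k - (k - (n + 1))) + 11 * ((n + 1) * (n + 1)) + 11 * n + 40)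
    (fun n k => by have := le_wordLength n k; nlinarith)
    (fun n k => by unfold wordLength; omega) (fun _ _ => Nat.le_add_right _ _)
    (fun n k => (tableSize_lt n k).le)
    (fun n k G => by
      have hB : (n + 1) ^ 2 + 1 ≤ wordLength n k := by
        have := le_wordLength n k
        rw [sq]; omega
      have hk : k - (k - (n + 1)) ≤ n + 1 := by omega
      rw [← decision_eq (isAdjMatrix_graphInput G k) k (two_pow_pow_lt_weightBase hk)]
      refine ⟨_, evalsTo_setup (isAtom_inputWorld_zero G k)
        (isAtom_inputWorld_one G k) fun w hw y m k' hy hm hk' => evalsTo_table hB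
          (holdsMatrix_graphInput G k) (weightBase_pos n)
          (fun i hi => weightBase_pow_lt (by nlinarith)) le_rfl (tableSize_lt n k) ?_ ?_ ?_
          ((isAtom_inputWorld_zero G k).mono hw) hk' hy hm⟩
      · intro i hi x hx
        rw [zeta_eq_sum_agree _ n i hi x hx]
        exact (sum_weight_le _ _).trans_lt (weightBase_pow_lt (by nlinarith))
      · exact fun x _ i hi => (submaskSum_pow_le _ x (hi.trans hk)).trans_lt
          (weightBase_pow_lt (by omega))
      · exact fun b => (paritySum_le _ b hk).trans_lt (weightBase_pow_lt le_rfl))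
  have hT : PolyBounded fun n k => C n k * (1 + 2 * wordLength n k) := by
    repeat' first
      | exact PolyBounded.const _ | exact PolyBounded.vertices | exact polyBounded_wordLength
      | exact polyBounded_popCost | exact polyBounded_zetaStepCost | exact polyBounded_weightCost
      | apply PolyBounded.add | apply PolyBounded.mul
  have hS : PolyBounded fun n k =>
      R * wordLength n k + (n * n + (n + 1)) * (2 * wordLength n k) := by
    repeat' first
      | exact PolyBounded.const _ | exact PolyBounded.vertices | exact polyBounded_wordLength
      | apply PolyBounded.add | apply PolyBounded.mul
  obtain ⟨P, hP⟩ := hT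
  obtain ⟨Q, hQ⟩ := hS
  refine ⟨p, P, Q, hp.mono (fun n k => ?_) (fun n k => ?_)⟩
  · refine le_trans ?_ (Nat.mul_le_mul_left (2 ^ n) (hP n k))
    rw [← mul_assoc (2 ^ n)]
    refine Nat.mul_le_mul_right _ ?_
    have h1 := tableCost_le (n := n) (k := k - (k - (n + 1))) (by omega)
    have h2 : 1 * (11 * ((n + 1) * (n + 1)) + 11 * n + 42) ≤
        2 ^ n * (11 * ((n + 1) * (n + 1)) + 11 * n + 42) :=
      Nat.mul_le_mul_right _ Nat.one_le_two_pow
    calc _ = tableCost n (k - (k - (n + 1))) +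
          1 * (11 * ((n + 1) * (n + 1)) + 11 * n + 42) := by ring
      _ ≤ _ := add_le_add h1 h2
      _ = _ := by simp only [C]; ring
  · refine le_trans ?_ (Nat.mul_le_mul_left (2 ^ n) (hQ n k))
    have h1 : 1 * (R * wordLength n k) ≤ 2 ^ n * (R * wordLength n k) :=
      Nat.mul_le_mul_right _ Nat.one_le_two_pow
    have h2 : 1 * (n * n * (2 * wordLength n k)) ≤ 2 ^ n * (n * n * (2 * wordLength n k)) :=
      Nat.mul_le_mul_right _ Nat.one_le_two_pow
    calc _ = 1 * (R * wordLength n k) + 1 * (n * n * (2 * wordLength n k)) +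
          2 ^ n * ((n + 1) * (2 * wordLength n k)) := by ring
      _ ≤ 2 ^ n * (R * wordLength n k) + 2 ^ n * (n * n * (2 * wordLength n k)) +
          2 ^ n * ((n + 1) * (2 * wordLength n k)) := by omega
      _ = _ := by ring

end RAM

/-- Given a graph on `n` vertices and a number `k`, the existence of a fall `k`-coloring can be
decided in time `3 ^ n` times a polynomial and polynomial space, and also in time and space `2 ^ n`
times a polynomial. The polynomials are evaluated at `n` plus the length of `k` in binary. -/
theorem mainTheorem11 :
    (∃ (p : RAM.Prog) (P Q : Polynomial ℕ), RAM.SolvesFallColoring p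
      (fun n k => 3 ^ n * P.eval (n + Nat.size k)) (fun n k => Q.eval (n + Nat.size k))) ∧
    (∃ (p : RAM.Prog) (P Q : Polynomial ℕ), RAM.SolvesFallColoring p
      (fun n k => 2 ^ n * P.eval (n + Nat.size k))
      (fun n k => 2 ^ n * Q.eval (n + Nat.size k))) := by
  exact ⟨RAM.exists_solves_polynomial_space, RAM.exists_solves_exponential_space⟩
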